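/- There is an absolute constant $C>0$ such that the following holds. Let $\mathcal G=(\mathcal V,\mathcal E)$ be a finite simple graph in which every vertex has the same degree $d$, and let $\{Y_i\}_{i\in\mathcal V}$ be independent, identically distributed real random variables whose common distribution is continuous (that is, $P(Y_i=y)=0$ for every real $y$). Let $X_i=1$ if $Y_i>Y_j$ for every neighbour $j$ of $i$, and $X_i=0$ otherwise. Let $W=\sum_{i\in\mathcal V}X_i$ be the number of local maxima, put $\sigma^2=\operatorname{Var}W$ with $\sigma\ge 0$, and suppose that $\sigma>0$. Let $\Phi$ be the standard normal distribution function. Then $$\sup_{z\in\mathbb R}\left|P(W\le z)-\Phi\!\left(\frac{z-EW}{\sigma}\right)\right|\le \frac{C\,d^2\,|\mathcal V|}{\sigma^3},$$ and, for every $z\in\mathbb R$, $$\left|P(W\le z)-\Phi\!\left(\frac{z-EW}{\sigma}\right)\right|\le C\left(1+\left|\frac{z-EW}{\sigma}\right|\right)^{-3}\frac{d^5\,|\mathcal V|}{\sigma^3}.$$ -/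

import Mathlib

open MeasureTheory ProbabilityTheory

noncomputable section

/-- The 0-1 indicator `X_i` of the event that `Y_i` is a local maximum: `Y_i > Y_j` for every
neighbour `j` of `i`. -/
def localMaxIndicator {V Ω : Type*} (G : SimpleGraph V) (Y : V → Ω → ℝ) (i : V) : Ω → ℝ :=
  Set.indicator {ω | ∀ j, G.Adj i j → Y j ω < Y i ω} (fun _ => 1)

/-- The number `W = ∑ i, X_i` of local maxima. -/
def numLocalMax {V Ω : Type*} [Fintype V] (G : SimpleGraph V) (Y : V → Ω → ℝ) : Ω → ℝ :=
  fun ω => ∑ i, localMaxIndicator G Y i ω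

/-- The standard normal distribution function `Φ`. -/
def stdNormalCDF (x : ℝ) : ℝ := cdf (gaussianReal 0 1) x

end

set_option linter.unusedSectionVars false

/-! The proof is Stein's method with an exchange coupling. Take two independent copies of the
configuration and let `W` be the normalized count of the first. Replacing coordinates one at a time
by those of the second copy telescopes `W - W'` into increments `D_j`. Since `W'` is centred and
independent of `W`, `E W g(W) = ∑ E D_j g(W)`. Exchanging the two copies at `j` preserves the law
and reverses the sign of `D_j`, so `E W g(W) = ½ ∑ E D_j (g(W) - g(W ∘ τ_j))`
(`SwapCoupling.integral_mul_eq`).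

Put `Δ_j = W - W ∘ τ_j`, `T = ½ ∑ D_j Δ_j`, `T* = ½ ∑ |D_j| Δ_j`, and let `g` be the solution `f` of
Stein's equation. Linearising leaves `E (1 - T) f'(W)` and a remainder. As `w f(w)` is increasing
and `1_{w ≤ z}` decreasing, the remainder is at most a combination of differences `|D_j| Δ_j (k(W) -
k(W ∘ τ_j))`. Now `|D_j| Δ_j` is again odd under the exchange, so these differences integrate
exactly to `2 E T* k(W)`. Hence `SwapCoupling.abs_integral_sub_stdNormalCDF_le` involves only `1 -
T` and `T*`, both centred, and no sum of absolute third moments.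

Both are sums over vertices of functions of balls of radius two, and each such ball meets at most
`(d + 1)^4` others. A closed neighbourhood contains a number of local maxima whose eighth moment is
bounded independently of `d` (`integral_locMaxNear_pow_eight_le`): eight nonadjacent vertices own
disjoint blocks of about `d / 8` neighbours, so they are jointly maximal with probability `O(d⁻⁸)`.
Thus the fourth moments of `1 - T` and `T*` are at most `(C d² √n / σ²)^4`, where `n` is the number
of vertices.

For the nonuniform bound, `(1 + |z|)³` times the Stein quantities is `O(1 + |W|³)`, which Young's
inequality pairs with these fourth moments (`SwapCoupling.nonuniform_bound`). The fourth moment of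
`W` comes from the coupling with `g(w) = w³`. Since `σ² = O(n)`, everything is governed by `ε = d² n
/ σ³`; for `ε ≥ 1` a Markov tail bound suffices. The outcome is a nonuniform bound with `d²`, which
gives both claims. -/

/-! ### The standard normal distribution function -/

/-- The standard normal density. -/
noncomputable def stdNormalPDF (x : ℝ) : ℝ := gaussianPDFReal 0 1 x

lemma stdNormalPDF_eq (x : ℝ) :
    stdNormalPDF x = (√(2 * Real.pi))⁻¹ * Real.exp (-x ^ 2 / 2) := by
  simp [stdNormalPDF, gaussianPDFReal]

lemma stdNormalPDF_pos (x : ℝ) : 0 < stdNormalPDF x :=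
  gaussianPDFReal_pos 0 1 x one_ne_zero

lemma stdNormalPDF_neg (x : ℝ) : stdNormalPDF (-x) = stdNormalPDF x := by
  simp [stdNormalPDF_eq]

lemma hasDerivAt_stdNormalPDF (x : ℝ) :
    HasDerivAt stdNormalPDF (-x * stdNormalPDF x) x := by
  have h : HasDerivAt (fun x : ℝ => (√(2 * Real.pi))⁻¹ * Real.exp (-x ^ 2 / 2))
      ((√(2 * Real.pi))⁻¹ * (Real.exp (-x ^ 2 / 2) * (-(2 * x) / 2))) x := by
    have h1 : HasDerivAt (fun x : ℝ => -x ^ 2 / 2) (-(2 * x) / 2) x := by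
      simpa using ((hasDerivAt_pow 2 x).neg).div_const 2
    exact (h1.exp).const_mul _
  have e : stdNormalPDF = fun x : ℝ => (√(2 * Real.pi))⁻¹ * Real.exp (-x ^ 2 / 2) :=
    funext stdNormalPDF_eq
  rw [e]
  convert h using 1
  ring

lemma continuous_stdNormalPDF : Continuous stdNormalPDF :=
  continuous_iff_continuousAt.2 fun x => (hasDerivAt_stdNormalPDF x).continuousAt

lemma stdNormalCDF_nonneg (x : ℝ) : 0 ≤ stdNormalCDF x := cdf_nonneg _ x

lemma stdNormalCDF_le_one (x : ℝ) : stdNormalCDF x ≤ 1 := cdf_le_one _ x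

lemma stdNormalCDF_eq_integral (x : ℝ) :
    stdNormalCDF x = ∫ t in Set.Iic x, stdNormalPDF t := by
  rw [stdNormalCDF, cdf_eq_real, Measure.real, gaussianReal_apply_eq_integral 0 one_ne_zero,
    ENNReal.toReal_ofReal]
  · rfl
  · exact integral_nonneg fun t => gaussianPDFReal_nonneg 0 1 t

lemma hasDerivAt_stdNormalCDF (x : ℝ) : HasDerivAt stdNormalCDF (stdNormalPDF x) x := by
  have hint : Integrable stdNormalPDF := integrable_gaussianPDFReal 0 1
  have e : stdNormalCDF = fun y => (∫ t in (0 : ℝ)..y, stdNormalPDF t) + stdNormalCDF 0 := by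
    funext y
    rw [stdNormalCDF_eq_integral y, stdNormalCDF_eq_integral 0,
      ← intervalIntegral.integral_Iic_sub_Iic hint.integrableOn hint.integrableOn]
    ring
  rw [e]
  exact (intervalIntegral.integral_hasDerivAt_right (hint.intervalIntegrable)
    (continuous_stdNormalPDF.stronglyMeasurableAtFilter _ _)
    continuous_stdNormalPDF.continuousAt).add_const _

lemma stdNormalCDF_neg (x : ℝ) : stdNormalCDF (-x) = 1 - stdNormalCDF x := by
  have hd : ∀ y, HasDerivAt (fun y => stdNormalCDF (-y) + stdNormalCDF y) 0 y := by
    intro y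
    have h1 := (hasDerivAt_stdNormalCDF (-y)).comp y (hasDerivAt_neg y)
    have h2 := h1.add (hasDerivAt_stdNormalCDF y)
    refine h2.congr_deriv ?_
    rw [stdNormalPDF_neg]; ring
  have hc : ∀ y, stdNormalCDF (-y) + stdNormalCDF y = stdNormalCDF (-x) + stdNormalCDF x :=
    fun y => is_const_of_deriv_eq_zero (fun y => (hd y).differentiableAt)
      (fun y => (hd y).deriv) y x
  have ht : Filter.Tendsto (fun y => stdNormalCDF (-y) + stdNormalCDF y) Filter.atTop
      (nhds (0 + 1)) :=
    ((tendsto_cdf_atBot _).comp Filter.tendsto_neg_atTop_atBot).add (tendsto_cdf_atTop _)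
  have := tendsto_nhds_unique (ht.congr hc) tendsto_const_nhds
  linarith

lemma stdNormalPDF_le (x : ℝ) : stdNormalPDF x ≤ Real.exp (-x ^ 2 / 2) := by
  rw [stdNormalPDF_eq]
  have h1 : 1 ≤ √(2 * Real.pi) := by
    rw [Real.one_le_sqrt]
    linarith [Real.pi_gt_three]
  exact mul_le_of_le_one_left (Real.exp_pos _).le (inv_le_one_of_one_le₀ h1)

/-- A function with nonnegative derivative vanishing at `-∞` is nonnegative. -/
lemma nonneg_of_hasDerivAt_nonneg_of_tendsto_atBot {k k' : ℝ → ℝ}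
    (hk : ∀ x, HasDerivAt k (k' x) x) (hk' : ∀ x, 0 ≤ k' x)
    (h0 : Filter.Tendsto k Filter.atBot (nhds 0)) (x : ℝ) : 0 ≤ k x := by
  have hm : Monotone k := monotone_of_deriv_nonneg (fun x => (hk x).differentiableAt)
    fun x => by rw [(hk x).deriv]; exact hk' x
  exact hm.le_of_tendsto h0 x

lemma tendsto_stdNormalPDF_atBot : Filter.Tendsto stdNormalPDF Filter.atBot (nhds 0) := by
  have h : Filter.Tendsto (fun x : ℝ => Real.exp (-x ^ 2 / 2)) Filter.atBot (nhds 0) := by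
    apply Real.tendsto_exp_atBot.comp
    have : Filter.Tendsto (fun x : ℝ => x ^ 2 / 2) Filter.atBot Filter.atTop :=
      ((Filter.tendsto_pow_atTop two_ne_zero).comp Filter.tendsto_neg_atBot_atTop
        |>.congr fun x => by simp).atTop_div_const (by norm_num)
    exact (Filter.tendsto_neg_atTop_atBot.comp this).congr fun x => by simp; ring
  exact squeeze_zero (fun x => (stdNormalPDF_pos x).le) stdNormalPDF_le h

/-- Mills' lower bound. -/
lemma neg_mul_stdNormalPDF_le (x : ℝ) :
    -x * stdNormalPDF x ≤ (1 + x ^ 2) * stdNormalCDF x := by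
  have hpos : ∀ x : ℝ, (1 + x ^ 2) ≠ 0 := fun x => by positivity
  -- Dividing the difference of the two sides by `1 + x²` gives a function that vanishes at `-∞` and
  -- has the positive derivative `2 φ / (1 + x²)²`.
  have h := nonneg_of_hasDerivAt_nonneg_of_tendsto_atBot
    (k := fun x => stdNormalCDF x + x / (1 + x ^ 2) * stdNormalPDF x)
    (k' := fun x => 2 * stdNormalPDF x / (1 + x ^ 2) ^ 2) ?_ ?_ ?_ x
  · have := mul_nonneg (by positivity : (0 : ℝ) ≤ 1 + x ^ 2) h
    rw [mul_add, ← mul_assoc, mul_div_cancel₀ _ (hpos x)] at this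
    linarith
  · intro x
    have h1 : HasDerivAt (fun x : ℝ => x / (1 + x ^ 2))
        ((1 * (1 + x ^ 2) - x * (2 * x)) / (1 + x ^ 2) ^ 2) x := by
      apply (hasDerivAt_id x).div _ (hpos x)
      simpa using (hasDerivAt_pow 2 x).const_add 1
    have h2 := (hasDerivAt_stdNormalCDF x).add (h1.mul (hasDerivAt_stdNormalPDF x))
    refine h2.congr_deriv ?_
    have := hpos x
    field_simp
    ring
  · intro x
    have := stdNormalPDF_pos x
    positivity
  · have h1 : Filter.Tendsto (fun x : ℝ => x / (1 + x ^ 2) * stdNormalPDF x) Filter.atBot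
        (nhds 0) := by
      apply squeeze_zero_norm _ tendsto_stdNormalPDF_atBot
      intro x
      rw [norm_mul, Real.norm_eq_abs, Real.norm_eq_abs, abs_of_pos (stdNormalPDF_pos x), abs_div,
        abs_of_pos (by positivity : (0 : ℝ) < 1 + x ^ 2)]
      apply mul_le_of_le_one_left (stdNormalPDF_pos x).le
      rw [div_le_one (by positivity)]
      nlinarith [sq_nonneg (|x| - 1), sq_abs x, abs_nonneg x]
    have h2 : Filter.Tendsto stdNormalCDF Filter.atBot (nhds 0) := tendsto_cdf_atBot _
    simpa using h2.add h1

/-- Mills' upper bound. -/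
lemma neg_mul_stdNormalCDF_le (x : ℝ) : -x * stdNormalCDF x ≤ stdNormalPDF x := by
  rcases le_or_gt 0 x with hx | hx
  · nlinarith [stdNormalPDF_pos x, mul_nonneg hx (stdNormalCDF_nonneg x)]
  -- On the negative half-line `φ(y)/|y| - Φ(y)` increases from its limit `0` at `-∞`.
  have hd : ∀ y ∈ Set.Iio (0 : ℝ), HasDerivAt (fun y => stdNormalPDF y * (-y⁻¹) - stdNormalCDF y)
      (stdNormalPDF y / y ^ 2) y := by
    intro y hy
    have hy' : y ≠ 0 := ne_of_lt hy
    refine (((hasDerivAt_stdNormalPDF y).mul (hasDerivAt_inv hy').neg).sub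
      (hasDerivAt_stdNormalCDF y)).congr_deriv ?_
    simp only [Pi.neg_apply]
    field_simp
    ring
  have hm : MonotoneOn (fun y => stdNormalPDF y * (-y⁻¹) - stdNormalCDF y) (Set.Iio 0) := by
    apply monotoneOn_of_deriv_nonneg (convex_Iio 0)
    · exact fun y hy => (hd y hy).continuousAt.continuousWithinAt
    · exact fun y hy => (hd y (interior_subset hy)).differentiableAt.differentiableWithinAt
    · intro y hy
      rw [(hd y (interior_subset hy)).deriv]
      have := stdNormalPDF_pos y
      positivity
  have ht : Filter.Tendsto (fun y => stdNormalPDF y * (-y⁻¹) - stdNormalCDF y) Filter.atBot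
      (nhds 0) := by
    have h1 : Filter.Tendsto stdNormalCDF Filter.atBot (nhds 0) := tendsto_cdf_atBot _
    simpa using (tendsto_stdNormalPDF_atBot.mul tendsto_inv_atBot_zero.neg).sub h1
  have h := le_of_tendsto ht ((Filter.eventually_le_atBot x).mono fun y hy =>
    hm (lt_of_le_of_lt hy hx) hx hy)
  have h3 := mul_nonneg (neg_nonneg.2 hx.le) h
  have h4 : -x * (stdNormalPDF x * (-x⁻¹)) = stdNormalPDF x := by
    have := hx.ne
    field_simp
  simp only at h3
  linarith

/-! ### The solution of Stein's equation -/

/-- The ratio `Φ / φ`. -/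
noncomputable def millsRatio (w : ℝ) : ℝ := stdNormalCDF w / stdNormalPDF w

lemma millsRatio_nonneg (w : ℝ) : 0 ≤ millsRatio w :=
  div_nonneg (stdNormalCDF_nonneg w) (stdNormalPDF_pos w).le

lemma hasDerivAt_millsRatio (w : ℝ) : HasDerivAt millsRatio (1 + w * millsRatio w) w := by
  refine ((hasDerivAt_stdNormalCDF w).div (hasDerivAt_stdNormalPDF w)
    (stdNormalPDF_pos w).ne').congr_deriv ?_
  have := (stdNormalPDF_pos w).ne'
  rw [millsRatio]
  field_simp
  ring

lemma neg_one_le_mul_millsRatio (w : ℝ) : -1 ≤ w * millsRatio w := by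
  rw [millsRatio, mul_div_assoc', le_div_iff₀ (stdNormalPDF_pos w)]
  linarith [neg_mul_stdNormalCDF_le w]

/-- The derivative is `w + (1 + w²) Φ/φ`, and its nonnegativity is exactly Mills' lower bound. -/
lemma monotone_mul_millsRatio : Monotone fun w => w * millsRatio w := by
  have hd : ∀ w, HasDerivAt (fun w => w * millsRatio w)
      (1 * millsRatio w + w * (1 + w * millsRatio w)) w := fun w =>
    (hasDerivAt_id w).mul (hasDerivAt_millsRatio w)
  apply monotone_of_deriv_nonneg (fun w => (hd w).differentiableAt)
  intro w
  rw [(hd w).deriv]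
  have h := neg_mul_stdNormalPDF_le w
  have h2 : -w ≤ (1 + w ^ 2) * millsRatio w := by
    rw [millsRatio, mul_div_assoc', le_div_iff₀ (stdNormalPDF_pos w)]
    exact h
  nlinarith

lemma continuous_millsRatio : Continuous millsRatio :=
  continuous_iff_continuousAt.2 fun x => (hasDerivAt_millsRatio x).continuousAt

/-- The bounded solution of Stein's equation `f' w - w f w = 1_{w ≤ z} - Φ z`. -/
noncomputable def steinSol (z w : ℝ) : ℝ :=
  if w ≤ z then (1 - stdNormalCDF z) * millsRatio w else stdNormalCDF z * millsRatio (-w)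

lemma steinSol_of_le {z w : ℝ} (h : w ≤ z) :
    steinSol z w = (1 - stdNormalCDF z) * millsRatio w := if_pos h

/-- The two branches agree at `w = z` by the symmetry of `Φ` and `φ`, so either formula may be used
there. -/
lemma steinSol_of_ge {z w : ℝ} (h : z ≤ w) :
    steinSol z w = stdNormalCDF z * millsRatio (-w) := by
  rcases h.eq_or_lt with rfl | h
  · rw [steinSol_of_le le_rfl, millsRatio, millsRatio, stdNormalCDF_neg, stdNormalPDF_neg]
    ring
  · exact if_neg (not_le.2 h)

lemma measurable_steinSol (z : ℝ) : Measurable (steinSol z) :=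
  Measurable.ite measurableSet_Iic (continuous_millsRatio.measurable.const_mul _)
    ((continuous_millsRatio.comp continuous_neg).measurable.const_mul _)

/-- Each branch is treated as a smooth function on the whole line, so that the mean value theorem
applies up to `z` without meeting the kink. -/
lemma hasDerivAt_steinSol_left (z w : ℝ) :
    HasDerivAt (fun w => (1 - stdNormalCDF z) * millsRatio w)
      (w * ((1 - stdNormalCDF z) * millsRatio w) + 1 - stdNormalCDF z) w := by
  refine ((hasDerivAt_millsRatio w).const_mul _).congr_deriv ?_
  ring

lemma hasDerivAt_steinSol_right (z w : ℝ) :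
    HasDerivAt (fun w => stdNormalCDF z * millsRatio (-w))
      (w * (stdNormalCDF z * millsRatio (-w)) - stdNormalCDF z) w := by
  refine ((((hasDerivAt_millsRatio (-w)).comp w (hasDerivAt_neg w))).const_mul _).congr_deriv ?_
  ring

/-- `w ↦ w f w` is monotone for the solution `f` of Stein's equation. -/
lemma monotone_mul_steinSol (z : ℝ) : Monotone fun w => w * steinSol z w := by
  have h1 : MonotoneOn (fun w => w * steinSol z w) (Set.Iic z) := by
    intro a ha b hb hab
    have := mul_le_mul_of_nonneg_left (monotone_mul_millsRatio hab)
      (sub_nonneg.2 (stdNormalCDF_le_one z))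
    simp only [steinSol_of_le ha, steinSol_of_le hb]
    linarith
  have h2 : MonotoneOn (fun w => w * steinSol z w) (Set.Ici z) := by
    intro a ha b hb hab
    have := mul_le_mul_of_nonneg_left (monotone_mul_millsRatio (neg_le_neg hab))
      (stdNormalCDF_nonneg z)
    simp only [steinSol_of_ge ha, steinSol_of_ge hb]
    linarith
  exact h1.Iic_union_Ici h2

/-- Away from `z`, `f'(w) = w f(w) + H(w) - Φ(z)` is an increasing plus a decreasing function. On
`[b, a]` it therefore lies between the combinations that take the two terms at opposite endpoints.
An interval containing `z` is split there and the estimates are added. -/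
lemma steinSol_sub_bounds {z a b : ℝ} (hab : b ≤ a) {H : ℝ → ℝ} (hH : Antitone H)
    (hlt : ∀ w < z, H w = 1) (hgt : ∀ w > z, H w = 0) :
    (b * steinSol z b + H a - stdNormalCDF z) * (a - b) ≤ steinSol z a - steinSol z b ∧
    steinSol z a - steinSol z b ≤ (a * steinSol z a + H b - stdNormalCDF z) * (a - b) := by
  have hg := monotone_mul_steinSol z
  have key : ∀ {x y c C : ℝ}, x ≤ y → (∃ f f' : ℝ → ℝ, (∀ w, HasDerivAt f (f' w) w) ∧
      f x = steinSol z x ∧ f y = steinSol z y ∧ ∀ w ∈ Set.Ioo x y, c ≤ f' w ∧ f' w ≤ C) →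
      c * (y - x) ≤ steinSol z y - steinSol z x ∧ steinSol z y - steinSol z x ≤ C * (y - x) := by
    rintro x y c C hxy ⟨f, f', hf, hx, hy, hb⟩
    rcases hxy.eq_or_lt with rfl | hlt
    · simp
    obtain ⟨w, hw, he⟩ := exists_hasDerivAt_eq_slope f f' hlt
      (fun w _ => (hf w).continuousAt.continuousWithinAt) (fun w _ => hf w)
    rw [eq_div_iff (sub_ne_zero.2 hlt.ne')] at he
    rw [← hx, ← hy, ← he]
    have := sub_pos.2 hlt
    exact ⟨mul_le_mul_of_nonneg_right (hb w hw).1 this.le,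
      mul_le_mul_of_nonneg_right (hb w hw).2 this.le⟩
  have left : ∀ {x y}, b ≤ x → x ≤ y → y ≤ a → y ≤ z →
      (b * steinSol z b + H a - stdNormalCDF z) * (y - x) ≤ steinSol z y - steinSol z x ∧
      steinSol z y - steinSol z x ≤ (a * steinSol z a + H b - stdNormalCDF z) * (y - x) := by
    intro x y hbx hxy hya hyz
    refine key hxy ⟨_, _, hasDerivAt_steinSol_left z, (steinSol_of_le (hxy.trans hyz)).symm,
      (steinSol_of_le hyz).symm, fun w hw => ?_⟩
    rw [← steinSol_of_le (hw.2.le.trans hyz)]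
    have h1 := hg (hbx.trans hw.1.le)
    have h2 := hg (hw.2.le.trans hya)
    have h3 := hH (hbx.trans hw.1.le)
    have h4 := hH (hw.2.le.trans hya)
    have h5 := hlt w (hw.2.trans_le hyz)
    simp only at h1 h2
    constructor <;> linarith
  have right : ∀ {x y}, b ≤ x → x ≤ y → y ≤ a → z ≤ x →
      (b * steinSol z b + H a - stdNormalCDF z) * (y - x) ≤ steinSol z y - steinSol z x ∧
      steinSol z y - steinSol z x ≤ (a * steinSol z a + H b - stdNormalCDF z) * (y - x) := by
    intro x y hbx hxy hya hyz
    refine key hxy ⟨_, _, hasDerivAt_steinSol_right z, (steinSol_of_ge hyz).symm,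
      (steinSol_of_ge (hyz.trans hxy)).symm, fun w hw => ?_⟩
    rw [← steinSol_of_ge (hyz.trans hw.1.le)]
    have h1 := hg (hbx.trans hw.1.le)
    have h2 := hg (hw.2.le.trans hya)
    have h3 := hH (hbx.trans hw.1.le)
    have h4 := hH (hw.2.le.trans hya)
    have h5 := hgt w (hyz.trans_lt hw.1)
    simp only at h1 h2
    constructor <;> linarith
  rcases le_total a z with haz | haz
  · exact left le_rfl hab le_rfl haz
  rcases le_total z b with hbz | hbz
  · exact right le_rfl hab le_rfl hbz
  obtain ⟨l1, l2⟩ := left le_rfl hbz haz le_rfl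
  obtain ⟨r1, r2⟩ := right hbz haz le_rfl le_rfl
  constructor <;> linarith

/-- The remainder in the first order expansion of the Stein solution. -/
lemma abs_steinSol_remainder_le {z : ℝ} (a b : ℝ) {H : ℝ → ℝ} (hH : Antitone H)
    (hlt : ∀ w < z, H w = 1) (hgt : ∀ w > z, H w = 0) :
    |(a - b) * (a * steinSol z a + H a - stdNormalCDF z) - (steinSol z a - steinSol z b)| ≤
      (a - b) * (a * steinSol z a - b * steinSol z b) + (a - b) * (H b - H a) := by
  rw [abs_le]
  rcases le_total b a with h | h
  · obtain ⟨h1, h2⟩ := steinSol_sub_bounds h hH hlt hgt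
    have h3 := mul_nonneg (sub_nonneg.2 h) (sub_nonneg.2 (monotone_mul_steinSol z h))
    have h4 := mul_nonneg (sub_nonneg.2 h) (sub_nonneg.2 (hH h))
    simp only at h3
    constructor <;> linarith
  · obtain ⟨h1, h2⟩ := steinSol_sub_bounds h hH hlt hgt
    have h3 := mul_nonneg (sub_nonneg.2 h) (sub_nonneg.2 (monotone_mul_steinSol z h))
    have h4 := mul_nonneg (sub_nonneg.2 h) (sub_nonneg.2 (hH h))
    simp only at h3
    constructor <;> linarith

/-- Mills' upper bound gives one inequality on each side of `z`; monotonicity carries each across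
`z`. -/
lemma abs_mul_steinSol_le_one (z w : ℝ) : |w * steinSol z w| ≤ 1 := by
  have c0 := stdNormalCDF_nonneg z
  have c1 := stdNormalCDF_le_one z
  have left : ∀ w ≤ z, -1 ≤ w * steinSol z w := by
    intro w hw
    rw [steinSol_of_le hw]
    nlinarith [neg_one_le_mul_millsRatio w]
  have right : ∀ w ≥ z, w * steinSol z w ≤ 1 := by
    intro w hw
    rw [steinSol_of_ge hw]
    nlinarith [neg_one_le_mul_millsRatio (-w)]
  have hm := monotone_mul_steinSol z
  rw [abs_le]
  rcases le_total w z with h | h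
  · exact ⟨left w h, (hm h).trans (right z le_rfl)⟩
  · exact ⟨(left z le_rfl).trans (hm h), right w h⟩

/-- The exponent is `z²/2 - (z/2)²/2`, the decay of `φ(z)/φ(z/2)` that governs the Stein solution
left of `z/2`. -/
lemma one_add_pow_three_le_exp (z : ℝ) :
    (1 + z) ^ 3 ≤ 128 * Real.exp (3 * z ^ 2 / 8) := by
  have h := Real.quadratic_le_exp_of_nonneg (by positivity : 0 ≤ 3 * z ^ 2 / 8)
  have h1 : (1 + z) ^ 3 ≤ 8 * (1 + z ^ 4) := by
    nlinarith [sq_nonneg (z - 1), sq_nonneg (z ^ 2 - 1), sq_nonneg (z ^ 2 - z)]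
  nlinarith [sq_nonneg z, sq_nonneg (z ^ 2)]

lemma one_sub_stdNormalCDF_le {z : ℝ} (hz : 1 ≤ z) :
    (1 + z) ^ 3 * (1 - stdNormalCDF z) ≤ 128 := by
  have h1 : 1 - stdNormalCDF z ≤ Real.exp (-(3 * z ^ 2 / 8)) := by
    have h2 := neg_mul_stdNormalCDF_le (-z)
    rw [stdNormalCDF_neg, stdNormalPDF_neg] at h2
    have h3 := stdNormalPDF_le z
    have h4 : Real.exp (-z ^ 2 / 2) ≤ Real.exp (-(3 * z ^ 2 / 8)) :=
      Real.exp_le_exp.2 (by nlinarith [sq_nonneg z])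
    nlinarith [stdNormalCDF_le_one z]
  calc (1 + z) ^ 3 * (1 - stdNormalCDF z)
      ≤ (128 * Real.exp (3 * z ^ 2 / 8)) * Real.exp (-(3 * z ^ 2 / 8)) := by
        apply mul_le_mul (one_add_pow_three_le_exp z) h1
          (sub_nonneg.2 (stdNormalCDF_le_one z)) (by positivity)
    _ = 128 := by rw [mul_assoc, ← Real.exp_add]; simp

/-- For `w ≤ 0` the quantity is at most `1 - Φ(z)`. For `w ≥ 0` monotonicity moves `w` to `z/2`,
Mills' bound gives `z (1 - Φ(z)) ≤ φ(z)`, and `φ(z/2)` cancels the denominator of the ratio. -/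
lemma abs_mul_steinSol_le_of_le_half {z w : ℝ} (hz : 1 ≤ z) (hw : w ≤ z / 2) :
    (1 + z) ^ 3 * |w * steinSol z w| ≤ 128 := by
  have hwz : w ≤ z := by linarith
  have c1 := stdNormalCDF_le_one z
  have hp : 0 < (1 + z) ^ 3 := by positivity
  rcases le_total w 0 with h0 | h0
  · have h1 : |w * steinSol z w| ≤ 1 - stdNormalCDF z := by
      rw [steinSol_of_le hwz, abs_of_nonpos]
      · nlinarith [neg_one_le_mul_millsRatio w]
      · exact mul_nonpos_of_nonpos_of_nonneg h0
          (mul_nonneg (sub_nonneg.2 c1) (millsRatio_nonneg w))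
    exact (mul_le_mul_of_nonneg_left h1 hp.le).trans (one_sub_stdNormalCDF_le hz)
  · have h1 : |w * steinSol z w| ≤ Real.exp (-(3 * z ^ 2 / 8)) := by
      rw [steinSol_of_le hwz, abs_of_nonneg
        (mul_nonneg h0 (mul_nonneg (sub_nonneg.2 c1) (millsRatio_nonneg w)))]
      have hm := monotone_mul_millsRatio hw
      have hr : millsRatio (z / 2) * stdNormalPDF (z / 2) ≤ 1 := by
        rw [millsRatio, div_mul_cancel₀ _ (stdNormalPDF_pos _).ne']
        exact stdNormalCDF_le_one _
      have h2 := neg_mul_stdNormalCDF_le (-z)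
      rw [stdNormalCDF_neg, stdNormalPDF_neg, neg_neg] at h2
      have he : stdNormalPDF z = Real.exp (-(3 * z ^ 2 / 8)) * stdNormalPDF (z / 2) := by
        rw [stdNormalPDF_eq, stdNormalPDF_eq, mul_left_comm, ← Real.exp_add]
        ring_nf
      have hm' : w * millsRatio w ≤ z / 2 * millsRatio (z / 2) := hm
      have hE := Real.exp_pos (-(3 * z ^ 2 / 8))
      calc w * ((1 - stdNormalCDF z) * millsRatio w)
          = (1 - stdNormalCDF z) * (w * millsRatio w) := by ring
        _ ≤ (1 - stdNormalCDF z) * (z / 2 * millsRatio (z / 2)) :=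
            mul_le_mul_of_nonneg_left hm' (sub_nonneg.2 c1)
        _ = (z * (1 - stdNormalCDF z)) * (millsRatio (z / 2) / 2) := by ring
        _ ≤ stdNormalPDF z * (millsRatio (z / 2) / 2) :=
            mul_le_mul_of_nonneg_right h2 (by linarith [millsRatio_nonneg (z / 2)])
        _ = Real.exp (-(3 * z ^ 2 / 8)) * ((millsRatio (z / 2) * stdNormalPDF (z / 2)) / 2) := by
            rw [he]; ring
        _ ≤ Real.exp (-(3 * z ^ 2 / 8)) * 1 :=
            mul_le_mul_of_nonneg_left (by linarith) hE.le
        _ = _ := mul_one _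
    calc (1 + z) ^ 3 * |w * steinSol z w|
        ≤ (128 * Real.exp (3 * z ^ 2 / 8)) * Real.exp (-(3 * z ^ 2 / 8)) :=
          mul_le_mul (one_add_pow_three_le_exp z) h1 (abs_nonneg _) (by positivity)
      _ = 128 := by rw [mul_assoc, ← Real.exp_add]; simp

lemma one_add_pow_three_le_of_half_le {z w : ℝ} (hz : 0 ≤ z) (hw : z / 2 ≤ w) :
    (1 + z) ^ 3 ≤ 32 * (1 + |w| ^ 3) := by
  have hw0 : 0 ≤ w := by linarith
  rw [abs_of_nonneg hw0]
  calc (1 + z) ^ 3 ≤ (1 + 2 * w) ^ 3 := by gcongr; linarith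
    _ ≤ 32 * (1 + w ^ 3) := by nlinarith [mul_nonneg hw0 (sq_nonneg (w - 1)), sq_nonneg (w - 1)]

/-- The nonuniform bounds on the Stein solution, for any version `H` of `1_{w ≤ z}`. -/
lemma steinSol_nonuniform_bounds {z : ℝ} (hz : 0 ≤ z) {H : ℝ → ℝ}
    (hlt : ∀ w < z, H w = 1) (hH0 : ∀ w, 0 ≤ H w)
    (hH1 : ∀ w, H w ≤ 1) (w : ℝ) :
    (1 + z) ^ 3 * |w * steinSol z w| ≤ 128 * (1 + |w| ^ 3) ∧
    (1 + z) ^ 3 * |w * steinSol z w + H w - stdNormalCDF z| ≤ 256 * (1 + |w| ^ 3) ∧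
    (1 + z) ^ 3 * (1 - H w) ≤ 32 * (1 + |w| ^ 3) := by
  have c0 := stdNormalCDF_nonneg z
  have c1 := stdNormalCDF_le_one z
  have hp : 0 < (1 + z) ^ 3 := by positivity
  have g1 := abs_mul_steinSol_le_one z w
  have w3 : 0 ≤ |w| ^ 3 := by positivity
  have h0 := hH0 w
  have h1 := hH1 w
  have f2 : |w * steinSol z w + H w - stdNormalCDF z| ≤ 2 := by
    rw [abs_le] at g1 ⊢; constructor <;> linarith
  -- If `|w|³` already dominates the weight, uniform bounds are enough. Otherwise `z ≥ 1` and `w <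
  -- z/2`, where the Gaussian decay applies and `H w = 1`.
  by_cases hb : (1 + z) ^ 3 ≤ 32 * (1 + |w| ^ 3)
  · refine ⟨?_, ?_, ?_⟩
    · nlinarith
    · nlinarith
    · nlinarith
  · have hz1 : 1 ≤ z := by
      by_contra hlt1
      apply hb
      have : (1 + z) ^ 3 ≤ 2 ^ 3 := by gcongr; linarith
      linarith
    have hw : w < z / 2 := by
      by_contra hw
      exact hb (one_add_pow_three_le_of_half_le hz (not_lt.1 hw))
    have e1 := abs_mul_steinSol_le_of_le_half hz1 hw.le
    have e2 := one_sub_stdNormalCDF_le hz1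
    rw [hlt w (by linarith)]
    refine ⟨by linarith, ?_, by linarith⟩
    have e3 : |w * steinSol z w + 1 - stdNormalCDF z| ≤
        |w * steinSol z w| + (1 - stdNormalCDF z) := by
      rw [add_sub_assoc]
      exact (abs_add_le _ _).trans (by rw [abs_of_nonneg (sub_nonneg.2 c1)])
    nlinarith [mul_le_mul_of_nonneg_left e3 hp.le]

/-! ### Bounded measurable functions -/

/-- Bounded measurable real functions. -/
structure BddMeas {Ω : Type*} [MeasurableSpace Ω] (f : Ω → ℝ) : Prop where
  measurable : Measurable f
  bdd : ∃ C, ∀ ω, |f ω| ≤ C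

namespace BddMeas

variable {Ω Ω' : Type*} [MeasurableSpace Ω] [MeasurableSpace Ω'] {f g : Ω → ℝ}

lemma const (c : ℝ) : BddMeas fun _ : Ω => c := ⟨measurable_const, |c|, fun _ => le_rfl⟩

lemma add (hf : BddMeas f) (hg : BddMeas g) : BddMeas fun ω => f ω + g ω := by
  obtain ⟨A, hA⟩ := hf.bdd
  obtain ⟨B, hB⟩ := hg.bdd
  exact ⟨hf.measurable.add hg.measurable, A + B,
    fun ω => (abs_add_le _ _).trans (add_le_add (hA ω) (hB ω))⟩

lemma mul (hf : BddMeas f) (hg : BddMeas g) : BddMeas fun ω => f ω * g ω := by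
  obtain ⟨A, hA⟩ := hf.bdd
  obtain ⟨B, hB⟩ := hg.bdd
  refine ⟨hf.measurable.mul hg.measurable, A * B, fun ω => ?_⟩
  rw [abs_mul]
  exact mul_le_mul (hA ω) (hB ω) (abs_nonneg _) ((abs_nonneg _).trans (hA ω))

lemma neg (hf : BddMeas f) : BddMeas fun ω => -f ω := by
  obtain ⟨A, hA⟩ := hf.bdd
  exact ⟨hf.measurable.neg, A, fun ω => by rw [abs_neg]; exact hA ω⟩

lemma sub (hf : BddMeas f) (hg : BddMeas g) : BddMeas fun ω => f ω - g ω := by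
  simpa only [sub_eq_add_neg] using hf.add hg.neg

lemma const_mul (c : ℝ) (hf : BddMeas f) : BddMeas fun ω => c * f ω := (const c).mul hf

lemma div_const (hf : BddMeas f) (c : ℝ) : BddMeas fun ω => f ω / c := by
  simpa only [div_eq_mul_inv] using hf.mul (const c⁻¹)

lemma abs (hf : BddMeas f) : BddMeas fun ω => |f ω| := by
  obtain ⟨A, hA⟩ := hf.bdd
  exact ⟨hf.measurable.abs, A, fun ω => by rw [abs_abs]; exact hA ω⟩

lemma pow (hf : BddMeas f) (k : ℕ) : BddMeas fun ω => f ω ^ k := by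
  obtain ⟨A, hA⟩ := hf.bdd
  exact ⟨hf.measurable.pow_const k, A ^ k, fun ω => by
    rw [abs_pow]; exact pow_le_pow_left₀ (abs_nonneg _) (hA ω) k⟩

lemma sum {ι : Type*} (s : Finset ι) {F : ι → Ω → ℝ} (hF : ∀ i, BddMeas (F i)) :
    BddMeas fun ω => ∑ i ∈ s, F i ω := by
  classical
  induction s using Finset.induction_on with
  | empty => simpa using const (Ω := Ω) 0
  | insert i s hi ih => simpa only [Finset.sum_insert hi] using (hF i).add ih

lemma prod {ι : Type*} (s : Finset ι) {F : ι → Ω → ℝ} (hF : ∀ i, BddMeas (F i)) :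
    BddMeas fun ω => ∏ i ∈ s, F i ω := by
  classical
  induction s using Finset.induction_on with
  | empty => simpa using const (Ω := Ω) 1
  | insert i s hi ih => simpa only [Finset.prod_insert hi] using (hF i).mul ih

lemma comp (hf : BddMeas f) {τ : Ω' → Ω} (hτ : Measurable τ) : BddMeas fun ω => f (τ ω) := by
  obtain ⟨A, hA⟩ := hf.bdd
  exact ⟨hf.measurable.comp hτ, A, fun ω => hA _⟩

lemma integrable (hf : BddMeas f) (P : Measure Ω) [IsFiniteMeasure P] : Integrable f P := by
  obtain ⟨A, hA⟩ := hf.bdd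
  exact Integrable.of_bound hf.measurable.aestronglyMeasurable A (ae_of_all _ hA)

end BddMeas

/-! ### Swap couplings -/

/-- A random variable `W` with a family of measure preserving involutions `τ j` and antisymmetric
variables `D j` such that `E W g(W) = ∑ j, E D_j g(W)`. -/
structure SwapCoupling {Ω J : Type*} [MeasurableSpace Ω] [Fintype J] (P : Measure Ω)
    (W : Ω → ℝ) (D : J → Ω → ℝ) (τ : J → Ω → Ω) : Prop where
  bddW : BddMeas W
  bddD : ∀ j, BddMeas (D j)
  mp : ∀ j, MeasurePreserving (τ j) P P
  invol : ∀ j ω, τ j (τ j ω) = ω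
  anti : ∀ j ω, D j (τ j ω) = -D j ω
  identity : ∀ g : ℝ → ℝ, BddMeas (fun ω => g (W ω)) →
    ∫ ω, W ω * g (W ω) ∂P = ∑ j, ∫ ω, D j ω * g (W ω) ∂P

namespace SwapCoupling

variable {Ω J : Type*} [MeasurableSpace Ω] [Fintype J] {P : Measure Ω} [IsProbabilityMeasure P]
  {W : Ω → ℝ} {D : J → Ω → ℝ} {τ : J → Ω → Ω}

/-- The difference `Δ_j = W - W ∘ τ_j`. -/
def diff (W : Ω → ℝ) (τ : J → Ω → Ω) (j : J) (ω : Ω) : ℝ := W ω - W (τ j ω)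

/-- `T = (1/2) ∑ D_j Δ_j`. -/
noncomputable def gain (W : Ω → ℝ) (D : J → Ω → ℝ) (τ : J → Ω → Ω) (ω : Ω) : ℝ :=
  ∑ j, D j ω * diff W τ j ω / 2

/-- `T* = (1/2) ∑ |D_j| Δ_j`. -/
noncomputable def absGain (W : Ω → ℝ) (D : J → Ω → ℝ) (τ : J → Ω → Ω) (ω : Ω) : ℝ :=
  ∑ j, |D j ω| * diff W τ j ω / 2

lemma bdd_diff (h : SwapCoupling P W D τ) (j : J) : BddMeas (diff W τ j) :=
  h.bddW.sub (h.bddW.comp (h.mp j).measurable)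

lemma bdd_gain (h : SwapCoupling P W D τ) : BddMeas (gain W D τ) :=
  BddMeas.sum _ fun j => ((h.bddD j).mul (h.bdd_diff j)).div_const 2

lemma bdd_absGain (h : SwapCoupling P W D τ) : BddMeas (absGain W D τ) :=
  BddMeas.sum _ fun j => ((h.bddD j).abs.mul (h.bdd_diff j)).div_const 2

lemma integral_comp_swap (h : SwapCoupling P W D τ) (j : J) {F : Ω → ℝ} (hF : BddMeas F) :
    ∫ ω, F (τ j ω) ∂P = ∫ ω, F ω ∂P := by
  have := integral_map (μ := P) (h.mp j).measurable.aemeasurable (f := F)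
    (by rw [(h.mp j).map_eq]; exact hF.measurable.aestronglyMeasurable)
  rw [(h.mp j).map_eq] at this
  exact this.symm

/-- If `A` changes sign under the swap then `E A (g - g ∘ τ) = 2 E A g`. -/
lemma integral_anti_mul_sub (h : SwapCoupling P W D τ) (j : J) {A g : Ω → ℝ} (hA : BddMeas A)
    (hg : BddMeas g) (hanti : ∀ ω, A (τ j ω) = -A ω) :
    ∫ ω, A ω * (g ω - g (τ j ω)) ∂P = 2 * ∫ ω, A ω * g ω ∂P := by
  have hgτ := hg.comp (h.mp j).measurable
  have e : ∫ ω, A ω * g (τ j ω) ∂P = -∫ ω, A ω * g ω ∂P := by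
    rw [← h.integral_comp_swap j (hA.mul hg), ← integral_neg]
    congr 1; funext ω; rw [hanti]; ring
  simp only [mul_sub]
  rw [integral_sub ((hA.mul hg).integrable P) ((hA.mul hgτ).integrable P), e]
  ring

/-- Oddness of `D_j` under its swap turns each term into a difference. With `g = id` the right side
is `E T`, so `E T = E W²`. -/
lemma integral_mul_eq (h : SwapCoupling P W D τ) {g : ℝ → ℝ} (hg : BddMeas fun ω => g (W ω)) :
    ∫ ω, W ω * g (W ω) ∂P = ∫ ω, ∑ j, D j ω * (g (W ω) - g (W (τ j ω))) / 2 ∂P := by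
  rw [integral_finsetSum, h.identity g hg]
  · refine Finset.sum_congr rfl fun j _ => ?_
    rw [integral_div, h.integral_anti_mul_sub j (h.bddD j) hg (h.anti j)]
    ring
  · exact fun j _ => (((h.bddD j).mul (hg.sub
      (hg.comp (h.mp j).measurable))).div_const 2).integrable P

/-- The swap fixes `|D_j|` and negates `Δ_j`, so `|D_j| Δ_j` is odd. This identity lets the Stein
remainder keep the cancellation between different `j`. -/
lemma integral_absGain_mul (h : SwapCoupling P W D τ) {g : ℝ → ℝ}
    (hg : BddMeas fun ω => g (W ω)) :
    ∫ ω, ∑ j, |D j ω| * diff W τ j ω * (g (W ω) - g (W (τ j ω))) / 2 ∂P =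
      2 * ∫ ω, absGain W D τ ω * g (W ω) ∂P := by
  have hA : ∀ j, BddMeas fun ω => |D j ω| * diff W τ j ω := fun j =>
    (h.bddD j).abs.mul (h.bdd_diff j)
  rw [integral_finsetSum]
  · simp only [absGain, Finset.sum_mul]
    rw [integral_finsetSum, Finset.mul_sum]
    · refine Finset.sum_congr rfl fun j _ => ?_
      rw [integral_div, h.integral_anti_mul_sub j (hA j) hg, ← integral_const_mul,
        ← integral_const_mul, ← integral_div]
      · congr 1; funext ω; ring
      · intro ω
        simp only [diff, h.anti, h.invol, abs_neg]
        ring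
    · exact fun j _ => (((hA j).div_const 2).mul hg).integrable P
  · exact fun j _ => (((hA j).mul (hg.sub
      (hg.comp (h.mp j).measurable))).div_const 2).integrable P

lemma integral_absGain (h : SwapCoupling P W D τ) : ∫ ω, absGain W D τ ω ∂P = 0 := by
  have := h.integral_absGain_mul (g := fun _ => 1) (BddMeas.const 1)
  simpa using this

lemma bdd_steinSol (h : SwapCoupling P W D τ) (z : ℝ) : BddMeas fun ω => steinSol z (W ω) := by
  obtain ⟨B, hB⟩ := h.bddW.bdd
  obtain ⟨C, hC⟩ := (isCompact_Icc (a := -B) (b := B)).exists_bound_of_continuousOn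
    continuous_millsRatio.continuousOn
  refine ⟨(measurable_steinSol z).comp h.bddW.measurable, C, fun ω => ?_⟩
  have c0 := stdNormalCDF_nonneg z
  have c1 := stdNormalCDF_le_one z
  have h1 := hC (W ω) (abs_le.1 (hB ω))
  have h2 := hC (-W ω) (abs_le.1 (by rw [abs_neg]; exact hB ω))
  rw [Real.norm_eq_abs] at h1 h2
  rcases le_total (W ω) z with hw | hw
  · rw [steinSol_of_le hw, abs_mul]
    exact (mul_le_of_le_one_left (abs_nonneg _) (abs_le.2 ⟨by linarith, by linarith⟩)).trans h1
  · rw [steinSol_of_ge hw, abs_mul]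
    exact (mul_le_of_le_one_left (abs_nonneg _) (abs_le.2 ⟨by linarith, by linarith⟩)).trans h2

/-- Stein's method bound for a swap coupling, for any version `H` of `1_{w ≤ z}`. -/
lemma abs_integral_sub_stdNormalCDF_le (h : SwapCoupling P W D τ) {z : ℝ} {H : ℝ → ℝ}
    (hH : Antitone H) (hlt : ∀ w < z, H w = 1) (hgt : ∀ w > z, H w = 0) (hH0 : ∀ w, 0 ≤ H w)
    (hH1 : ∀ w, H w ≤ 1) :
    |∫ ω, H (W ω) ∂P - stdNormalCDF z| ≤
      ∫ ω, (|1 - gain W D τ ω| *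
          |W ω * steinSol z (W ω) + H (W ω) - stdNormalCDF z| +
        2 * (|absGain W D τ ω| * |W ω * steinSol z (W ω)|) +
        2 * (|absGain W D τ ω| * (1 - H (W ω)))) ∂P := by
  have hf := h.bdd_steinSol z
  have hHW : BddMeas fun ω => H (W ω) :=
    ⟨hH.measurable.comp h.bddW.measurable, 1, fun ω => abs_le.2
      ⟨by linarith [hH0 (W ω)], hH1 _⟩⟩
  have hg : BddMeas fun ω => W ω * steinSol z (W ω) := h.bddW.mul hf
  have hf' : BddMeas fun ω => W ω * steinSol z (W ω) + H (W ω) - stdNormalCDF z :=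
    (hg.add hHW).sub (BddMeas.const _)
  have hgτ := fun j => hg.comp (h.mp j).measurable
  have hHτ := fun j => hHW.comp (h.mp j).measurable
  have hfτ := fun j => hf.comp (h.mp j).measurable
  have hT := h.bdd_gain
  have hA := h.bdd_absGain
  have hR : BddMeas fun ω => ∑ j, D j ω * (diff W τ j ω *
      (W ω * steinSol z (W ω) + H (W ω) - stdNormalCDF z) -
      (steinSol z (W ω) - steinSol z (W (τ j ω)))) / 2 :=
    BddMeas.sum _ fun j => ((h.bddD j).mul (((h.bdd_diff j).mul hf').sub
      (hf.sub (hfτ j)))).div_const 2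
  -- Stein's equation: the left side is `E f'(W) - E W f(W)`. The second term is expanded by the
  -- coupling, and `T f'(W)` is added and subtracted.
  have e1 : ∫ ω, H (W ω) ∂P - stdNormalCDF z =
      ∫ ω, (1 - gain W D τ ω) * (W ω * steinSol z (W ω) + H (W ω) - stdNormalCDF z) ∂P +
      ∫ ω, ∑ j, D j ω * (diff W τ j ω *
      (W ω * steinSol z (W ω) + H (W ω) - stdNormalCDF z) -
      (steinSol z (W ω) - steinSol z (W (τ j ω)))) / 2 ∂P := by
    have i1 : ∫ ω, H (W ω) ∂P - stdNormalCDF z =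
        ∫ ω, (W ω * steinSol z (W ω) + H (W ω) - stdNormalCDF z) ∂P -
        ∫ ω, W ω * steinSol z (W ω) ∂P := by
      rw [← integral_sub (hf'.integrable P) (hg.integrable P)]
      have : ∫ ω, H (W ω) - stdNormalCDF z ∂P = ∫ ω, H (W ω) ∂P - stdNormalCDF z := by
        rw [integral_sub (hHW.integrable P) (integrable_const _)]; simp
      rw [← this]
      congr 1; funext ω; ring
    rw [i1, h.integral_mul_eq hf, ← integral_sub (hf'.integrable P),
      ← integral_add ((((BddMeas.const 1).sub hT).mul hf').integrable P) (hR.integrable P)]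
    · congr 1; funext ω
      have : gain W D τ ω * (W ω * steinSol z (W ω) + H (W ω) - stdNormalCDF z) =
          ∑ j, D j ω * diff W τ j ω / 2 *
            (W ω * steinSol z (W ω) + H (W ω) - stdNormalCDF z) := by
        rw [gain, Finset.sum_mul]
      rw [sub_mul, this, one_mul, sub_add, sub_right_inj, ← Finset.sum_sub_distrib]
      refine Finset.sum_congr rfl fun j _ => ?_
      ring
    · exact (BddMeas.sum _ fun j => ((h.bddD j).mul (hf.sub (hfτ j))).div_const 2).integrable P
  have hq1 : BddMeas fun ω => ∑ j, |D j ω| * diff W τ j ω *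
      (W ω * steinSol z (W ω) - W (τ j ω) * steinSol z (W (τ j ω))) / 2 :=
    BddMeas.sum _ fun j => (((h.bddD j).abs.mul (h.bdd_diff j)).mul (hg.sub (hgτ j))).div_const 2
  have hq2 : BddMeas fun ω => ∑ j, |D j ω| * diff W τ j ω *
      ((1 - H (W ω)) - (1 - H (W (τ j ω)))) / 2 :=
    BddMeas.sum _ fun j => (((h.bddD j).abs.mul (h.bdd_diff j)).mul
      (((BddMeas.const 1).sub hHW).sub ((BddMeas.const 1).sub (hHτ j)))).div_const 2
  have e2 := h.integral_absGain_mul (g := fun w => w * steinSol z w) hg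
  have e3 := h.integral_absGain_mul (g := fun w => 1 - H w) ((BddMeas.const 1).sub hHW)
  have b1 := (((BddMeas.const 1).sub hT).abs.mul hf'.abs)
  have b2 := (hA.abs.mul hg.abs).const_mul 2
  have b3 := (hA.abs.mul ((BddMeas.const 1).sub hHW)).const_mul 2
  rw [e1, integral_add ((b1.add b2).integrable P) (b3.integrable P),
    integral_add (b1.integrable P) (b2.integrable P), add_assoc]
  refine (abs_add_le _ _).trans (add_le_add ?_ ?_)
  · refine abs_integral_le_integral_abs.trans (le_of_eq ?_)
    congr 1; funext ω; rw [abs_mul]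
  · calc |∫ ω, ∑ j, D j ω * (diff W τ j ω *
          (W ω * steinSol z (W ω) + H (W ω) - stdNormalCDF z) -
          (steinSol z (W ω) - steinSol z (W (τ j ω)))) / 2 ∂P|
        ≤ ∫ ω, |∑ j, D j ω * (diff W τ j ω *
          (W ω * steinSol z (W ω) + H (W ω) - stdNormalCDF z) -
          (steinSol z (W ω) - steinSol z (W (τ j ω)))) / 2| ∂P := abs_integral_le_integral_abs
      _ ≤ ∫ ω, (∑ j, |D j ω| * diff W τ j ω *
          (W ω * steinSol z (W ω) - W (τ j ω) * steinSol z (W (τ j ω))) / 2 +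
          ∑ j, |D j ω| * diff W τ j ω * ((1 - H (W ω)) - (1 - H (W (τ j ω)))) / 2) ∂P := by
          refine integral_mono (hR.abs.integrable P) ((hq1.add hq2).integrable P) fun ω => ?_
          simp only
          rw [← Finset.sum_add_distrib]
          -- The remainder is bounded pathwise, for each `j`, by differences of increasing
          -- functions. After integration they recombine exactly into `T*`, and only then are
          -- absolute values taken.
          refine (Finset.abs_sum_le_sum_abs _ _).trans (Finset.sum_le_sum fun j _ => ?_)
          have := mul_le_mul_of_nonneg_left
            (abs_steinSol_remainder_le (W ω) (W (τ j ω)) hH hlt hgt) (abs_nonneg (D j ω))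
          rw [abs_div, abs_mul, abs_two, diff]
          rw [← add_div]
          refine div_le_div_of_nonneg_right ?_ two_pos.le
          linarith
      _ = 2 * ∫ ω, absGain W D τ ω * (W ω * steinSol z (W ω)) ∂P +
          2 * ∫ ω, absGain W D τ ω * (1 - H (W ω)) ∂P := by
          rw [integral_add (hq1.integrable P) (hq2.integrable P), e2, e3]
      _ ≤ _ := by
          rw [integral_const_mul, integral_const_mul]
          refine add_le_add (mul_le_mul_of_nonneg_left ?_ two_pos.le)
            (mul_le_mul_of_nonneg_left ?_ two_pos.le)
          · refine integral_mono ((hA.mul hg).integrable P)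
              ((hA.abs.mul hg.abs).integrable P) fun ω => ?_
            simp only
            rw [← abs_mul]; exact le_abs_self _
          · refine integral_mono ((hA.mul ((BddMeas.const 1).sub hHW)).integrable P)
              ((hA.abs.mul ((BddMeas.const 1).sub hHW)).integrable P) fun ω => ?_
            exact mul_le_mul_of_nonneg_right (le_abs_self _) (sub_nonneg.2 (hH1 _))

/-- Young's inequality with exponents `4` and `4/3`, after rescaling `S` by `s`. -/
lemma abs_mul_one_add_pow_le {s : ℝ} (hs : 0 < s) (S w : ℝ) :
    |S| * (1 + |w| ^ 3) ≤ s * (3 / 4 + (S ^ 4 / s ^ 4) / 2 + 3 / 4 * w ^ 4) := by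
  obtain ⟨u, hu⟩ : ∃ u, |S| = s * u := ⟨|S| / s, by field_simp⟩
  have hu4 : S ^ 4 / s ^ 4 = u ^ 4 := by
    rw [← Even.pow_abs (by decide : Even 4) S, hu, mul_pow]
    field_simp
  rw [hu4, hu, mul_assoc]
  refine mul_le_mul_of_nonneg_left ?_ hs.le
  have hw4 : w ^ 4 = |w| ^ 4 := (Even.pow_abs (by decide : Even 4) w).symm
  rw [hw4]
  set v := |w|
  have h1 : 0 ≤ u ^ 4 + 3 * v ^ 4 - 4 * u * v ^ 3 := by
    have : u ^ 4 + 3 * v ^ 4 - 4 * u * v ^ 3 = (u - v) ^ 2 * ((u + v) ^ 2 + 2 * v ^ 2) := by ring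
    rw [this]; positivity
  have h2 : 0 ≤ u ^ 4 + 3 - 4 * u := by
    have : u ^ 4 + 3 - 4 * u = (u - 1) ^ 2 * ((u + 1) ^ 2 + 2) := by ring
    rw [this]; positivity
  linarith

lemma integral_abs_mul_one_add_pow_le {s : ℝ} (hs : 0 < s) {S : Ω → ℝ} (hS : BddMeas S)
    (hW : BddMeas W) (h4 : ∫ ω, S ω ^ 4 ∂P ≤ s ^ 4) :
    ∫ ω, |S ω| * (1 + |W ω| ^ 3) ∂P ≤ s * (2 + ∫ ω, W ω ^ 4 ∂P) := by
  have b1 := ((hS.pow 4).div_const (s ^ 4)).div_const 2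
  have b2 := (hW.pow 4).const_mul (3 / 4)
  have b0 := BddMeas.const (Ω := Ω) (3 / 4)
  have hW4 : 0 ≤ ∫ ω, W ω ^ 4 ∂P := integral_nonneg fun ω => by positivity
  calc ∫ ω, |S ω| * (1 + |W ω| ^ 3) ∂P
      ≤ ∫ ω, s * (3 / 4 + (S ω ^ 4 / s ^ 4) / 2 + 3 / 4 * W ω ^ 4) ∂P :=
        integral_mono ((hS.abs.mul ((BddMeas.const 1).add (hW.abs.pow 3))).integrable P)
          ((((b0.add b1).add b2).const_mul s).integrable P)
          fun ω => abs_mul_one_add_pow_le hs _ _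
    _ = s * (3 / 4 + (∫ ω, S ω ^ 4 ∂P) / s ^ 4 / 2 + 3 / 4 * ∫ ω, W ω ^ 4 ∂P) := by
        rw [integral_const_mul, integral_add ((b0.add b1).integrable P) (b2.integrable P),
          integral_add (b0.integrable P) (b1.integrable P), integral_div, integral_div,
          integral_const_mul, integral_div]
        simp
    _ ≤ _ := by
        refine mul_le_mul_of_nonneg_left ?_ hs.le
        have : (∫ ω, S ω ^ 4 ∂P) / s ^ 4 ≤ 1 := (div_le_one (by positivity)).2 h4
        linarith

lemma nonuniform_bound_of_nonneg (h : SwapCoupling P W D τ) {z s : ℝ} (hz : 0 ≤ z) (hs : 0 < s)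
    (hT : ∫ ω, (1 - gain W D τ ω) ^ 4 ∂P ≤ s ^ 4) (hA : ∫ ω, absGain W D τ ω ^ 4 ∂P ≤ s ^ 4)
    {H : ℝ → ℝ}
    (hH : Antitone H) (hlt : ∀ w < z, H w = 1) (hgt : ∀ w > z, H w = 0) (hH0 : ∀ w, 0 ≤ H w)
    (hH1 : ∀ w, H w ≤ 1) :
    (1 + z) ^ 3 * |∫ ω, H (W ω) ∂P - stdNormalCDF z| ≤
      600 * s * (2 + ∫ ω, W ω ^ 4 ∂P) := by
  have hp : 0 < (1 + z) ^ 3 := by positivity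
  have hb := steinSol_nonuniform_bounds hz hlt hH0 hH1
  have h1T : BddMeas fun ω => 1 - gain W D τ ω := (BddMeas.const 1).sub h.bdd_gain
  have i1 := integral_abs_mul_one_add_pow_le hs h1T h.bddW hT
  have i2 := integral_abs_mul_one_add_pow_le hs h.bdd_absGain h.bddW hA
  have hHW : BddMeas fun ω => H (W ω) :=
    ⟨hH.measurable.comp h.bddW.measurable, 1, fun ω => abs_le.2
      ⟨by linarith [hH0 (W ω)], hH1 _⟩⟩
  have hg := h.bddW.mul (h.bdd_steinSol z)
  have hf' := (hg.add hHW).sub (BddMeas.const (stdNormalCDF z))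
  have hw3 := (BddMeas.const 1).add (h.bddW.abs.pow 3)
  have m1 := (h1T.abs.mul hw3).const_mul 256
  have m2 := (h.bdd_absGain.abs.mul hw3).const_mul 320
  have hW4 : 0 ≤ ∫ ω, W ω ^ 4 ∂P := integral_nonneg fun ω => by positivity
  calc (1 + z) ^ 3 * |∫ ω, H (W ω) ∂P - stdNormalCDF z|
      ≤ (1 + z) ^ 3 * _ := mul_le_mul_of_nonneg_left
        (h.abs_integral_sub_stdNormalCDF_le hH hlt hgt hH0 hH1) hp.le
    -- `320 = 2 * 128 + 2 * 32` collects the two terms containing `T*`.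
    _ ≤ ∫ ω, (256 * (|1 - gain W D τ ω| * (1 + |W ω| ^ 3)) +
          320 * (|absGain W D τ ω| * (1 + |W ω| ^ 3))) ∂P := by
        rw [← integral_const_mul]
        refine integral_mono (BddMeas.integrable (((((h1T.abs.mul hf'.abs).add
          ((h.bdd_absGain.abs.mul hg.abs).const_mul 2)).add ((h.bdd_absGain.abs.mul
          ((BddMeas.const 1).sub hHW)).const_mul 2))).const_mul _) P)
          ((m1.add m2).integrable P) fun ω => ?_
        obtain ⟨c1, c2, c3⟩ := hb (W ω)
        have d1 := mul_le_mul_of_nonneg_left c1 (abs_nonneg (absGain W D τ ω))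
        have d2 := mul_le_mul_of_nonneg_left c2 (abs_nonneg (1 - gain W D τ ω))
        have d3 := mul_le_mul_of_nonneg_left c3 (abs_nonneg (absGain W D τ ω))
        simp only
        linarith
    _ = 256 * ∫ ω, |1 - gain W D τ ω| * (1 + |W ω| ^ 3) ∂P +
          320 * ∫ ω, |absGain W D τ ω| * (1 + |W ω| ^ 3) ∂P := by
        rw [integral_add (m1.integrable P) (m2.integrable P), integral_const_mul,
          integral_const_mul]
    _ ≤ _ := by nlinarith

/-- Reflection reduces `z ≤ 0` to `z ≥ 0`; `T` is unchanged and `T*` changes sign. -/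
lemma neg (h : SwapCoupling P W D τ) :
    SwapCoupling P (fun ω => -W ω) (fun j ω => -D j ω) τ where
  bddW := h.bddW.neg
  bddD j := (h.bddD j).neg
  mp := h.mp
  invol := h.invol
  anti j ω := by rw [h.anti]
  identity g hg := by
    have := h.identity (fun w => g (-w)) hg
    simp only [neg_mul, integral_neg, this, Finset.sum_neg_distrib]

lemma gain_neg : gain (fun ω => -W ω) (fun j ω => -D j ω) τ = gain W D τ := by
  funext ω; simp only [gain, diff]
  exact Finset.sum_congr rfl fun j _ => by ring

lemma absGain_neg : absGain (fun ω => -W ω) (fun j ω => -D j ω) τ = fun ω => -absGain W D τ ω := by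
  funext ω; simp only [absGain, diff, ← Finset.sum_neg_distrib]
  exact Finset.sum_congr rfl fun j _ => by rw [abs_neg]; ring

/-- The nonuniform Berry-Esseen bound for a swap coupling. -/
theorem nonuniform_bound (h : SwapCoupling P W D τ) {s : ℝ} (hs : 0 < s)
    (hT : ∫ ω, (1 - gain W D τ ω) ^ 4 ∂P ≤ s ^ 4) (hA : ∫ ω, absGain W D τ ω ^ 4 ∂P ≤ s ^ 4)
    (z : ℝ) :
    (1 + |z|) ^ 3 * |P.real {ω | W ω ≤ z} - stdNormalCDF z| ≤
      600 * s * (2 + ∫ ω, W ω ^ 4 ∂P) := by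
  have hms : MeasurableSet {ω | W ω ≤ z} := measurableSet_le h.bddW.measurable measurable_const
  rcases le_total 0 z with hz | hz
  · have := h.nonuniform_bound_of_nonneg hz hs hT hA (H := (Set.Iic z).indicator 1)
      (fun a b hab => ?_) (fun w hw => by simp [hw.le]) (fun w hw => by simp [not_le.2 hw])
      (fun w => Set.indicator_nonneg (fun _ _ => zero_le_one) _)
      (fun w => Set.indicator_le_self' (fun _ _ => zero_le_one) _)
    · rw [abs_of_nonneg hz]
      rwa [show (∫ ω, (Set.Iic z).indicator 1 (W ω) ∂P) = P.real {ω | W ω ≤ z} from ?_] at this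
      rw [← integral_indicator_one hms]
      rfl
    · simp only [Set.indicator, Set.mem_Iic, Pi.one_apply]
      split_ifs <;> linarith
  -- `P(W ≤ z) = 1 - P(-W < -z)` has a strict inequality, so the open half-line indicator is needed.
  -- This is why `H` was left free at `z`.
  · have := h.neg.nonuniform_bound_of_nonneg (neg_nonneg.2 hz) hs (by rw [gain_neg]; exact hT)
      (by rw [absGain_neg]; simpa [Even.neg_pow (by decide : Even 4)] using hA)
      (H := (Set.Iio (-z)).indicator 1)
      (fun a b hab => ?_) (fun w hw => Set.indicator_of_mem (Set.mem_Iio.2 hw) _)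
      (fun w hw => Set.indicator_of_notMem (Set.notMem_Iio.2 (le_of_lt hw)) _)
      (fun w => Set.indicator_nonneg (fun _ _ => zero_le_one) _)
      (fun w => Set.indicator_le_self' (fun _ _ => zero_le_one) _)
    · rw [abs_of_nonpos hz]
      rw [show (∫ ω, (Set.Iio (-z)).indicator 1 (-W ω) ∂P) = 1 - P.real {ω | W ω ≤ z} from ?_,
        stdNormalCDF_neg, abs_sub_comm, sub_sub_sub_cancel_left] at this
      · simpa [Even.neg_pow (by decide : Even 4)] using this
      · rw [← probReal_compl_eq_one_sub hms, ← integral_indicator_one hms.compl]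
        congr 1; funext ω
        simp [Set.indicator]
    · simp only [Set.indicator, Set.mem_Iio, Pi.one_apply]
      split_ifs <;> linarith

end SwapCoupling

namespace SwapCoupling

variable {Ω J : Type*} [MeasurableSpace Ω] [Fintype J] {P : Measure Ω} [IsProbabilityMeasure P]
  {W : Ω → ℝ} {D : J → Ω → ℝ} {τ : J → Ω → Ω}

/-- Fourth moment bound for a swap coupling. -/
lemma fourth_moment_le (h : SwapCoupling P W D τ) {s lam K : ℝ} (hs : 0 < s) (hlam : 0 < lam)
    (hW2 : ∫ ω, W ω ^ 2 ∂P ≤ 1)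
    (hT : ∫ ω, (1 - gain W D τ ω) ^ 4 ∂P ≤ s ^ 4)
    (h6 : ∀ j, ∫ ω, D j ω ^ 2 * diff W τ j ω ^ 4 ∂P ≤ K * lam ^ 6)
    (h4 : ∀ j, ∫ ω, |D j ω| * |diff W τ j ω| ^ 3 ∂P ≤ K * lam ^ 4) :
    ∫ ω, W ω ^ 4 ∂P ≤
      6 + 9 * s ^ 2 + Fintype.card J * (3 / 2 * (1 + K) * lam ^ 3 + K * lam ^ 4) := by
  have hT' : BddMeas fun ω => 1 - gain W D τ ω := (BddMeas.const 1).sub h.bdd_gain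
  have bW2 := h.bddW.pow 2
  have bW4 := h.bddW.pow 4
  have b1 := bW2.const_mul 3
  have b2 := bW4.const_mul (1 / 2)
  have b3 := ((BddMeas.const (Ω := Ω) (s ^ 2)).add ((hT'.pow 4).div_const (s ^ 2))).const_mul (9 / 4)
  have b4 : ∀ _ : J, BddMeas fun ω => lam ^ 3 * W ω ^ 2 := fun _ => bW2.const_mul _
  have b5 : ∀ j, BddMeas fun ω => D j ω ^ 2 * diff W τ j ω ^ 4 := fun j =>
    ((h.bddD j).pow 2).mul ((h.bdd_diff j).pow 4)
  have b6 : ∀ j, BddMeas fun ω => |D j ω| * |diff W τ j ω| ^ 3 := fun j =>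
    ((h.bddD j).abs).mul ((h.bdd_diff j).abs.pow 3)
  have b7 : ∀ j, BddMeas fun ω => 3 / 4 * (lam ^ 3 * W ω ^ 2 +
      D j ω ^ 2 * diff W τ j ω ^ 4 / lam ^ 3) + 1 / 2 * (|D j ω| * |diff W τ j ω| ^ 3) := fun j =>
    (((b4 j).add ((b5 j).div_const _)).const_mul _).add ((b6 j).const_mul _)
  have key : ∫ ω, W ω ^ 4 ∂P ≤ ∫ ω, (3 * W ω ^ 2 + 1 / 2 * W ω ^ 4 +
      9 / 4 * (s ^ 2 + (1 - gain W D τ ω) ^ 4 / s ^ 2) +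
      ∑ j, (3 / 4 * (lam ^ 3 * W ω ^ 2 +
      D j ω ^ 2 * diff W τ j ω ^ 4 / lam ^ 3) + 1 / 2 * (|D j ω| * |diff W τ j ω| ^ 3))) ∂P := by
    have e1 : ∫ ω, W ω ^ 4 ∂P = ∫ ω, W ω * (fun w : ℝ => w ^ 3) (W ω) ∂P := by
      congr 1; funext ω; ring
    rw [e1, h.integral_mul_eq (g := fun w : ℝ => w ^ 3) (h.bddW.pow 3)]
    refine integral_mono (BddMeas.integrable (BddMeas.sum _ fun j => ((h.bddD j).mul
      ((h.bddW.pow 3).sub ((h.bddW.comp (h.mp j).measurable).pow 3))).div_const 2) P)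
      (BddMeas.integrable (((b1.add b2).add b3).add (BddMeas.sum _ b7)) P) fun ω => ?_
    -- The expansion `W³ - (W - Δ)³ = 3 W² Δ - 3 W Δ² + Δ³` has leading part `3 T W²`. Writing `T =
    -- 1 - x`, the cross term costs half of `W⁴`, later absorbed on the left, and a multiple of
    -- `x²`.
    have e2 : 3 * gain W D τ ω * W ω ^ 2 ≤ 3 * W ω ^ 2 + 1 / 2 * W ω ^ 4 +
        9 / 4 * (s ^ 2 + (1 - gain W D τ ω) ^ 4 / s ^ 2) := by
      set x := 1 - gain W D τ ω
      have hx : gain W D τ ω = 1 - x := by simp [x]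
      have h1 : x ^ 2 ≤ (s ^ 2 + x ^ 4 / s ^ 2) / 2 := by
        have : x ^ 4 / s ^ 2 = (x ^ 2 / s) ^ 2 := by rw [div_pow]; ring
        rw [this]
        have e : x ^ 2 = s * (x ^ 2 / s) := by field_simp
        nlinarith [sq_nonneg (s - x ^ 2 / s)]
      rw [hx]
      nlinarith [sq_nonneg (W ω ^ 2 + 3 * x)]
    have e3 : ∑ j, D j ω * (W ω ^ 3 - W (τ j ω) ^ 3) / 2 = 3 * gain W D τ ω * W ω ^ 2 +
        ∑ j, (-3 / 2 * (D j ω * diff W τ j ω ^ 2 * W ω) +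
          1 / 2 * (D j ω * diff W τ j ω ^ 3)) := by
      rw [gain, Finset.mul_sum, Finset.sum_mul, ← Finset.sum_add_distrib]
      refine Finset.sum_congr rfl fun j _ => ?_
      rw [diff]; ring
    simp only
    rw [e3]
    refine add_le_add e2 (Finset.sum_le_sum fun j _ => add_le_add ?_ ?_)
    · have hl : 0 < lam ^ 3 := by positivity
      have e : D j ω ^ 2 * diff W τ j ω ^ 4 / lam ^ 3 =
          lam ^ 3 * (D j ω * diff W τ j ω ^ 2 / lam ^ 3) ^ 2 := by field_simp
      have e' : D j ω * diff W τ j ω ^ 2 * W ω =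
          lam ^ 3 * ((D j ω * diff W τ j ω ^ 2 / lam ^ 3) * W ω) := by field_simp
      rw [e, e']
      nlinarith [mul_nonneg hl.le (sq_nonneg (D j ω * diff W τ j ω ^ 2 / lam ^ 3 + W ω))]
    · rw [← abs_pow, ← abs_mul]
      exact mul_le_mul_of_nonneg_left (le_abs_self _) (by norm_num)
  rw [integral_add (((b1.add b2).add b3).integrable P) ((BddMeas.sum _ b7).integrable P),
    integral_add ((b1.add b2).integrable P) (b3.integrable P),
    integral_add (b1.integrable P) (b2.integrable P), integral_const_mul, integral_const_mul,
    integral_const_mul, integral_add ((BddMeas.const _).integrable P)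
      (((hT'.pow 4).div_const _).integrable P), integral_div,
    integral_finsetSum _ fun j _ => (b7 j).integrable P] at key
  have hsum : ∑ j, ∫ ω, (3 / 4 * (lam ^ 3 * W ω ^ 2 +
      D j ω ^ 2 * diff W τ j ω ^ 4 / lam ^ 3) + 1 / 2 * (|D j ω| * |diff W τ j ω| ^ 3)) ∂P ≤
      ∑ j : J, (3 / 4 * (1 + K) * lam ^ 3 + 1 / 2 * (K * lam ^ 4)) := by
    refine Finset.sum_le_sum fun j _ => ?_
    rw [integral_add ((((b4 j).add ((b5 j).div_const _)).const_mul _).integrable P)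
      (((b6 j).const_mul _).integrable P), integral_const_mul, integral_const_mul,
      integral_add ((b4 j).integrable P) (((b5 j).div_const _).integrable P), integral_const_mul,
      integral_div]
    have i1 : (∫ ω, D j ω ^ 2 * diff W τ j ω ^ 4 ∂P) / lam ^ 3 ≤ K * lam ^ 3 := by
      rw [div_le_iff₀ (by positivity)]
      calc _ ≤ _ := h6 j
        _ = _ := by ring
    have i2 := h4 j
    have i3 : lam ^ 3 * ∫ ω, W ω ^ 2 ∂P ≤ lam ^ 3 :=
      mul_le_of_le_one_right (by positivity) hW2
    linarith
  rw [Finset.sum_const, Finset.card_univ, nsmul_eq_mul] at hsum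
  have hT2 : (∫ ω, (1 - gain W D τ ω) ^ 4 ∂P) / s ^ 2 ≤ s ^ 2 := by
    rw [div_le_iff₀ (by positivity)]
    calc _ ≤ _ := hT
      _ = _ := by ring
  have hc : ∫ _, s ^ 2 ∂P = s ^ 2 := by simp
  rw [hc] at key
  linarith

end SwapCoupling

/-! ### Sums of locally dependent variables -/

section LocalSum

variable {Ω J : Type*} [MeasurableSpace Ω] {P : Measure Ω} [IsProbabilityMeasure P]

lemma sum_pow_four_le (s : Finset J) (t : J → ℝ) :
    (∑ j ∈ s, t j) ^ 4 ≤ (s.card : ℝ) ^ 3 * ∑ j ∈ s, t j ^ 4 := by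
  have h1 := sq_sum_le_card_mul_sum_sq (s := s) (f := t)
  have h2 := sq_sum_le_card_mul_sum_sq (s := s) (f := fun j => t j ^ 2)
  have h0 : 0 ≤ (∑ j ∈ s, t j) ^ 2 := sq_nonneg _
  calc (∑ j ∈ s, t j) ^ 4 = ((∑ j ∈ s, t j) ^ 2) ^ 2 := by ring
    _ ≤ ((s.card : ℝ) * ∑ j ∈ s, t j ^ 2) ^ 2 := pow_le_pow_left₀ h0 h1 2
    _ = (s.card : ℝ) ^ 2 * (∑ j ∈ s, t j ^ 2) ^ 2 := by ring
    _ ≤ (s.card : ℝ) ^ 2 * (s.card * ∑ j ∈ s, (t j ^ 2) ^ 2) :=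
        mul_le_mul_of_nonneg_left h2 (by positivity)
    _ = _ := by
        simp only [← pow_mul]; ring

/-- The cost of deleting from `s` the part `r` that depends on `t`. Summed over `n` terms, `s⁴/(2n)`
uses half of `s⁴`; the powers of `d` balance `t` against `r`, a sum of about `d` terms of its size.
-/
lemma mul_cube_sub_cube_le {n d : ℝ} (hn : 0 < n) (hd : 0 < d) (t r s : ℝ) :
    t * s ^ 3 ≤ t * (s - r) ^ 3 + (s ^ 4 / (2 * n) +
      (81 / 16 * n) * (d ^ 2 * t ^ 4 + r ^ 4 / d ^ 2) +
      5 / 2 * (d ^ 3 * t ^ 4 + r ^ 4 / d)) := by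
  obtain ⟨u, rfl⟩ : ∃ u, r = d * u := ⟨r / d, by field_simp⟩
  have e1 : (d * u) ^ 4 / d ^ 2 = d ^ 2 * u ^ 4 := by field_simp
  have e2 : (d * u) ^ 4 / d = d ^ 3 * u ^ 4 := by field_simp
  rw [e1, e2]
  have h1 : t * s ^ 3 - t * (s - d * u) ^ 3 ≤
      |t * (d * u)| * (9 / 2 * s ^ 2 + 5 / 2 * (d * u) ^ 2) := by
    have : t * s ^ 3 - t * (s - d * u) ^ 3 =
      (t * (d * u)) * (3 * s ^ 2 - 3 * s * (d * u) + (d * u) ^ 2) := by ring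
    rw [this]
    have hp : 0 ≤ 3 * s ^ 2 - 3 * s * (d * u) + (d * u) ^ 2 := by
      nlinarith [sq_nonneg (3 * s - 3 / 2 * (d * u)), sq_nonneg (d * u), sq_nonneg (s - d * u)]
    refine (mul_le_mul_of_nonneg_right (le_abs_self _) hp).trans
      (mul_le_mul_of_nonneg_left ?_ (abs_nonneg _))
    nlinarith [sq_nonneg (s + d * u)]
  set x := |t * (d * u)| with hx
  have hx2 : x ^ 2 = d ^ 2 * (t ^ 2 * u ^ 2) := by rw [hx, sq_abs]; ring
  have h2 : 9 / 2 * (x * s ^ 2) ≤ s ^ 4 / (2 * n) + 81 / 8 * n * x ^ 2 := by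
    obtain ⟨v, hv⟩ : ∃ v, s ^ 2 = n * v := ⟨s ^ 2 / n, by field_simp⟩
    have e : s ^ 4 / (2 * n) = n * v ^ 2 / 2 := by
      rw [show s ^ 4 = (s ^ 2) ^ 2 by ring, hv]; field_simp
    rw [e, hv]
    nlinarith [mul_nonneg hn.le (sq_nonneg (v - 9 / 2 * x))]
  have h3 : 81 / 8 * n * x ^ 2 ≤ (81 / 16 * n) * (d ^ 2 * t ^ 4 + d ^ 2 * u ^ 4) := by
    rw [hx2]
    have : t ^ 2 * u ^ 2 ≤ (t ^ 4 + u ^ 4) / 2 := by nlinarith [sq_nonneg (t ^ 2 - u ^ 2)]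
    have := mul_le_mul_of_nonneg_left this (by positivity : 0 ≤ 81 / 8 * n * d ^ 2)
    linarith
  have h4 : x * (d * u) ^ 2 ≤ d ^ 3 * t ^ 4 + d ^ 3 * u ^ 4 := by
    have e : x * (d * u) ^ 2 = d ^ 3 * (|t * u| * u ^ 2) := by
      rw [hx, show t * (d * u) = d * (t * u) by ring, abs_mul d, abs_of_pos hd]; ring
    rw [e, ← mul_add]
    refine mul_le_mul_of_nonneg_left ?_ (by positivity)
    have a : (|t * u|) ^ 2 = t ^ 2 * u ^ 2 := by rw [sq_abs]; ring
    nlinarith [sq_nonneg (t ^ 2 - u ^ 2), sq_nonneg (|t * u| - u ^ 2), sq_nonneg (t ^ 2)]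
  linarith

/-- Fourth moment of a sum of locally dependent variables. -/
lemma integral_sum_pow_four_le [Fintype J] {T : J → Ω → ℝ} (hT : ∀ j, BddMeas (T j))
    {B : J → Finset J} {d K : ℝ} (hd : 0 < d) (hdJ : d ≤ Fintype.card J)
    (hB : ∀ j, ((B j).card : ℝ) ≤ d)
    (hK : ∀ j, ∫ ω, T j ω ^ 4 ∂P ≤ K)
    (hind : ∀ j, ∫ ω, T j ω * (∑ k, T k ω - ∑ k ∈ B j, T k ω) ^ 3 ∂P = 0) :
    ∫ ω, (∑ j, T j ω) ^ 4 ∂P ≤ 31 * (Fintype.card J) ^ 2 * d ^ 2 * K := by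
  set n : ℝ := (Fintype.card J : ℝ) with hn_def
  have hn : 0 < n := hd.trans_le hdJ
  have bS : BddMeas fun ω => ∑ j, T j ω := BddMeas.sum _ hT
  have bR : ∀ j, BddMeas fun ω => ∑ k ∈ B j, T k ω := fun j => BddMeas.sum _ hT
  obtain ⟨j0⟩ : Nonempty J := by
    rw [← Fintype.card_pos_iff]; exact Nat.cast_pos.1 hn
  have hK0 : 0 ≤ K := (integral_nonneg fun ω => by positivity).trans (hK j0)
  have hR4 : ∀ j, ∫ ω, (∑ k ∈ B j, T k ω) ^ 4 ∂P ≤ d ^ 4 * K := by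
    intro j
    calc ∫ ω, (∑ k ∈ B j, T k ω) ^ 4 ∂P
        ≤ ∫ ω, ((B j).card : ℝ) ^ 3 * ∑ k ∈ B j, T k ω ^ 4 ∂P :=
          integral_mono (((bR j).pow 4).integrable P)
            (((BddMeas.sum _ fun k => (hT k).pow 4).const_mul _).integrable P)
            fun ω => sum_pow_four_le _ _
      _ = ((B j).card : ℝ) ^ 3 * ∑ k ∈ B j, ∫ ω, T k ω ^ 4 ∂P := by
          rw [integral_const_mul, integral_finsetSum _ fun k _ => ((hT k).pow 4).integrable P]
      _ ≤ ((B j).card : ℝ) ^ 3 * ∑ k ∈ B j, K := by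
          gcongr with k; exact hK k
      _ = ((B j).card : ℝ) ^ 4 * K := by
          rw [Finset.sum_const, nsmul_eq_mul]; ring
      _ ≤ d ^ 4 * K := by gcongr; exact hB j
  have b0 : ∀ j, BddMeas fun ω => T j ω * (∑ k, T k ω - ∑ k ∈ B j, T k ω) ^ 3 := fun j =>
    (hT j).mul ((bS.sub (bR j)).pow 3)
  have b1 := (bS.pow 4).div_const (2 * n)
  have b2 : ∀ j, BddMeas fun ω =>
      (81 / 16 * n) * (d ^ 2 * T j ω ^ 4 + (∑ k ∈ B j, T k ω) ^ 4 / d ^ 2) := fun j =>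
    ((((hT j).pow 4).const_mul _).add (((bR j).pow 4).div_const _)).const_mul _
  have b3 : ∀ j, BddMeas fun ω =>
      5 / 2 * (d ^ 3 * T j ω ^ 4 + (∑ k ∈ B j, T k ω) ^ 4 / d) := fun j =>
    ((((hT j).pow 4).const_mul _).add (((bR j).pow 4).div_const _)).const_mul _
  have each : ∀ j, ∫ ω, T j ω * (∑ k, T k ω) ^ 3 ∂P ≤
      (∫ ω, (∑ k, T k ω) ^ 4 ∂P) / (2 * n) + 81 / 8 * n * d ^ 2 * K + 5 * d ^ 3 * K := by
    intro j
    have := integral_mono (((hT j).mul (bS.pow 3)).integrable P)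
      (((b0 j).add ((b1.add (b2 j)).add (b3 j))).integrable P)
      fun ω => mul_cube_sub_cube_le hn hd (T j ω) (∑ k ∈ B j, T k ω) (∑ k, T k ω)
    rw [integral_add ((b0 j).integrable P) (((b1.add (b2 j)).add (b3 j)).integrable P), hind,
      integral_add ((b1.add (b2 j)).integrable P) ((b3 j).integrable P),
      integral_add (b1.integrable P) ((b2 j).integrable P), integral_const_mul,
      integral_const_mul, integral_add (((((hT j).pow 4).const_mul _)).integrable P)
        ((((bR j).pow 4).div_const _).integrable P),
      integral_add (((((hT j).pow 4).const_mul _)).integrable P)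
        ((((bR j).pow 4).div_const _).integrable P), integral_const_mul, integral_const_mul,
      integral_div, integral_div, integral_div] at this
    have r1 : (∫ ω, (∑ k ∈ B j, T k ω) ^ 4 ∂P) / d ^ 2 ≤ d ^ 2 * K := by
      rw [div_le_iff₀ (by positivity)]
      calc _ ≤ _ := hR4 j
        _ = _ := by ring
    have r2 : (∫ ω, (∑ k ∈ B j, T k ω) ^ 4 ∂P) / d ≤ d ^ 3 * K := by
      rw [div_le_iff₀ (by positivity)]
      calc _ ≤ _ := hR4 j
        _ = _ := by ring
    have r3 := mul_le_mul_of_nonneg_left (hK j) (by positivity : 0 ≤ d ^ 2)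
    have r4 := mul_le_mul_of_nonneg_left (hK j) (by positivity : 0 ≤ d ^ 3)
    have r5 := mul_le_mul_of_nonneg_left (add_le_add r3 r1) (by positivity : 0 ≤ 81 / 16 * n)
    linarith
  -- Half of the fourth moment reappears on the right of the summed estimate and is absorbed. The
  -- term in `d³ n` is brought under `d² n²` by `d ≤ n`.
  have tot : ∫ ω, (∑ j, T j ω) ^ 4 ∂P = ∑ j, ∫ ω, T j ω * (∑ k, T k ω) ^ 3 ∂P := by
    rw [← integral_finsetSum _ fun j _ => ((hT j).mul (bS.pow 3)).integrable P]
    congr 1; funext ω; rw [← Finset.sum_mul]; ring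
  have hsum := Finset.sum_le_sum fun j (_ : j ∈ Finset.univ) => each j
  rw [← tot, Finset.sum_const, Finset.card_univ, nsmul_eq_mul, ← hn_def] at hsum
  have hh : n * ((∫ ω, (∑ k, T k ω) ^ 4 ∂P) / (2 * n)) = (∫ ω, (∑ k, T k ω) ^ 4 ∂P) / 2 := by
    field_simp
  have hd3 : n * (d ^ 3 * K) ≤ n ^ 2 * d ^ 2 * K := by
    have := mul_le_mul_of_nonneg_left hdJ (by positivity : 0 ≤ n * d ^ 2 * K)
    linarith
  have hnn : 0 ≤ n ^ 2 * d ^ 2 * K := by positivity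
  nlinarith

end LocalSum

/-! ### Functions of disjoint sets of coordinates -/

section Coordinates

variable {V E : Type*} [Fintype V] [MeasurableSpace E]

lemma indepFun_of_dependsOn (ν : Measure E) [IsProbabilityMeasure ν] {f g : (V → E) → ℝ}
    {S S' : Finset V} (hf : Measurable f) (hg : Measurable g) (hfS : DependsOn f (S : Set V))
    (hgS : DependsOn g (S' : Set V)) (hSS : Disjoint S S') :
    IndepFun f g (Measure.pi fun _ : V => ν) := by
  classical
  obtain ⟨e0⟩ : Nonempty E := by
    by_contra hE
    rw [not_nonempty_iff] at hE
    exact IsProbabilityMeasure.ne_zero ν (Measure.eq_zero_of_isEmpty ν)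
  have hi : iIndepFun (fun (v : V) (y : V → E) => y v) (Measure.pi fun _ : V => ν) :=
    iIndepFun_pi (X := fun _ => id) fun _ => aemeasurable_id
  have h := hi.indepFun_finset S S' hSS fun v => measurable_pi_apply v
  -- Filling the missing coordinates with an arbitrary point factors each function through the
  -- coordinates it depends on.
  let ext (A : Finset V) (x : A → E) (v : V) : E := if h : v ∈ A then x ⟨v, h⟩ else e0
  have hext : ∀ A, Measurable (ext A) := by
    intro A
    refine measurable_pi_iff.2 fun v => ?_
    by_cases hv : v ∈ A
    · simpa [ext, hv] using measurable_pi_apply _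
    · simp [ext, hv]
  have := h.comp (hf.comp (hext S)) (hg.comp (hext S'))
  convert this using 1
  · funext y
    refine hfS fun v hv => ?_
    have hv' : v ∈ S := hv
    simp [ext, hv']
  · funext y
    refine hgS fun v hv => ?_
    have hv' : v ∈ S' := hv
    simp [ext, hv']

lemma integral_mul_of_dependsOn (ν : Measure E) [IsProbabilityMeasure ν] {f g : (V → E) → ℝ}
    {S S' : Finset V} (hf : Measurable f) (hg : Measurable g) (hfS : DependsOn f (S : Set V))
    (hgS : DependsOn g (S' : Set V)) (hSS : Disjoint S S') :
    ∫ y, f y * g y ∂(Measure.pi fun _ : V => ν) =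
      (∫ y, f y ∂(Measure.pi fun _ : V => ν)) * ∫ y, g y ∂(Measure.pi fun _ : V => ν) :=
  (indepFun_of_dependsOn ν hf hg hfS hgS hSS).integral_fun_mul_eq_mul_integral
    hf.aestronglyMeasurable hg.aestronglyMeasurable

/-- Fourth central moment of a sum of functions, each depending on few coordinates. -/
lemma integral_sum_sub_pow_four_le (ν : Measure E) [IsProbabilityMeasure ν]
    {T : V → (V → E) → ℝ} (hT : ∀ j, BddMeas (T j)) {S B : V → Finset V}
    (hS : ∀ j, DependsOn (T j) (S j : Set V))
    (hSB : ∀ j k, k ∉ B j → Disjoint (S j) (S k)) {d K : ℝ} (hd : 0 < d)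
    (hdV : d ≤ Fintype.card V) (hB : ∀ j, ((B j).card : ℝ) ≤ d)
    (hK : ∀ j, ∫ y, T j y ^ 4 ∂(Measure.pi fun _ : V => ν) ≤ K) :
    ∫ y, (∑ j, T j y - ∑ j, ∫ y, T j y ∂(Measure.pi fun _ : V => ν)) ^ 4
      ∂(Measure.pi fun _ : V => ν) ≤ 31 * (Fintype.card V) ^ 2 * d ^ 2 * (16 * K) := by
  classical
  set P := Measure.pi fun _ : V => ν
  set c : V → ℝ := fun j => ∫ y, T j y ∂P with hc
  have bT : ∀ j, BddMeas fun y => T j y - c j := fun j => (hT j).sub (BddMeas.const _)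
  have hS' : ∀ j, DependsOn (fun y => T j y - c j) (S j : Set V) := fun j x y hxy => by
    simp only [hS j hxy]
  have h := integral_sum_pow_four_le (P := P) bT hd hdV hB (K := 16 * K) ?_ ?_
  · simpa only [Finset.sum_sub_distrib] using h
  · intro j
    -- By Jensen, centring costs at most the factor `16` in the fourth moment.
    have hc4 : c j ^ 4 ≤ ∫ y, T j y ^ 4 ∂P := by
      have := (Even.convexOn_pow (𝕜 := ℝ) (by decide : Even 4)).map_integral_le
        (μ := P) (f := T j) (continuous_pow 4).continuousOn isClosed_univ
        (ae_of_all _ fun _ => Set.mem_univ _) ((hT j).integrable P) (((hT j).pow 4).integrable P)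
      simpa using this
    calc ∫ y, (T j y - c j) ^ 4 ∂P ≤ ∫ y, 8 * (T j y ^ 4 + c j ^ 4) ∂P := by
          refine integral_mono (((bT j).pow 4).integrable P)
            (((((hT j).pow 4).add (BddMeas.const _)).const_mul 8).integrable P) fun y => ?_
          simp only
          set a := T j y
          set b := c j
          have h2 : (a - b) ^ 2 ≤ 2 * (a ^ 2 + b ^ 2) := by nlinarith [sq_nonneg (a + b)]
          have h3 := pow_le_pow_left₀ (sq_nonneg (a - b)) h2 2
          nlinarith [sq_nonneg (a ^ 2 - b ^ 2)]
      _ = 8 * (∫ y, T j y ^ 4 ∂P + c j ^ 4) := by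
          rw [integral_const_mul, integral_add (((hT j).pow 4).integrable P)
            (integrable_const _)]
          simp
      _ ≤ 16 * K := by linarith [hK j]
  · intro j
    have e : ∀ y, (∑ k, (T k y - c k) - ∑ k ∈ B j, (T k y - c k)) =
        ∑ k ∈ (B j)ᶜ, (T k y - c k) := fun y => by
      rw [← Finset.sum_add_sum_compl (B j), add_sub_cancel_left]
    simp only [e]
    have bR : BddMeas fun y => (∑ k ∈ (B j)ᶜ, (T k y - c k)) ^ 3 := (BddMeas.sum _ bT).pow 3
    rw [integral_mul_of_dependsOn ν (S := S j) (S' := (B j)ᶜ.biUnion S) (bT j).measurable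
      bR.measurable (hS' j)]
    · rw [integral_sub ((hT j).integrable P) (integrable_const _)]
      simp [hc]
    · intro x y hxy
      simp only
      congr 1
      refine Finset.sum_congr rfl fun k hk => hS' k fun v hv => hxy v ?_
      exact Finset.mem_coe.2 (Finset.mem_biUnion.2 ⟨k, hk, hv⟩)
    · rw [Finset.disjoint_biUnion_right]
      exact fun k hk => hSB j k (Finset.mem_compl.1 hk)

end Coordinates

/-! ### Local maxima of independent variables -/

section LocalMax

variable {V : Type*} [Fintype V]

/-- Greedy choice of disjoint blocks. -/
lemma exists_disjoint_blocks (A : V → Finset V) (m : ℕ) (S : Finset V)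
    (h : ∀ i ∈ S, S.card * m ≤ (A i).card) :
    ∃ E : V → Finset V, (∀ i ∈ S, E i ⊆ A i ∧ (E i).card = m) ∧
      ∀ i ∈ S, ∀ k ∈ S, i ≠ k → Disjoint (E i) (E k) := by
  classical
  induction S using Finset.induction_on with
  | empty => exact ⟨fun _ => ∅, by simp, by simp⟩
  | insert a S ha ih =>
    rw [Finset.card_insert_of_notMem ha] at h
    obtain ⟨E, hE, hdis⟩ := ih fun i hi =>
      (Nat.mul_le_mul_right m (Nat.le_succ _)).trans (h i (Finset.mem_insert_of_mem hi))
    have hcard : (S.biUnion E).card ≤ S.card * m := by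
      refine Finset.card_biUnion_le.trans ?_
      rw [Finset.sum_congr rfl fun i hi => (hE i hi).2, Finset.sum_const, smul_eq_mul]
    have hm : m ≤ (A a \ S.biUnion E).card := by
      have h1 := h a (Finset.mem_insert_self _ _)
      have h2 := Finset.le_card_sdiff (S.biUnion E) (A a)
      have h3 : (S.card + 1) * m = S.card * m + m := by ring
      omega
    obtain ⟨F, hF, hFm⟩ := Finset.exists_subset_card_eq hm
    have hFS : ∀ k ∈ S, Disjoint F (E k) := fun k hk =>
      (Finset.disjoint_of_subset_right (Finset.subset_biUnion_of_mem E hk)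
        (Finset.disjoint_of_subset_left hF Finset.sdiff_disjoint))
    have hne : ∀ k ∈ S, k ≠ a := fun k hk hka => ha (hka ▸ hk)
    refine ⟨Function.update E a F, ?_, ?_⟩
    · intro i hi
      rcases Finset.mem_insert.1 hi with rfl | hi
      · simpa using ⟨hF.trans Finset.sdiff_subset, hFm⟩
      · rw [Function.update_of_ne (hne i hi)]
        exact hE i hi
    · intro i hi k hk hik
      rcases Finset.mem_insert.1 hi with rfl | hi' <;>
        rcases Finset.mem_insert.1 hk with hka | hk'
      · exact absurd hka.symm hik
      · rw [Function.update_self, Function.update_of_ne (hne k hk')]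
        exact hFS k hk'
      · rw [hka, Function.update_self, Function.update_of_ne (hne i hi')]
        exact (hFS i hi').symm
      · rw [Function.update_of_ne (hne i hi'), Function.update_of_ne (hne k hk')]
        exact hdis i hi' k hk' hik

variable (μ : Measure ℝ) [IsProbabilityMeasure μ]

/-- The event that the coordinate `i` is the strict maximum over `B`. -/
def strictMaxOn (B : Finset V) (i : V) : Set (V → ℝ) := {y | ∀ v ∈ B, v ≠ i → y v < y i}

lemma measurableSet_strictMaxOn (B : Finset V) (i : V) : MeasurableSet (strictMaxOn B i) := by
  have : strictMaxOn B i = ⋂ v ∈ B, {y : V → ℝ | v ≠ i → y v < y i} := by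
    ext y; simp [strictMaxOn]
  rw [this]
  refine Finset.measurableSet_biInter _ fun v _ => ?_
  by_cases hv : v = i
  · simp [hv]
  · simpa [hv] using measurableSet_lt (measurable_pi_apply v) (measurable_pi_apply i)

/-- By exchangeability the events for the different members of `B` have equal probability, and they
are disjoint. Ties only lose mass. -/
lemma measure_strictMaxOn_le (B : Finset V) {i : V} (hi : i ∈ B) :
    (Measure.pi fun _ : V => μ).real (strictMaxOn B i) ≤ 1 / B.card := by
  classical
  set P := Measure.pi fun _ : V => μ
  have hsym : ∀ k ∈ B, P.real (strictMaxOn B k) = P.real (strictMaxOn B i) := by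
    intro k hk
    have hmp := measurePreserving_piCongrLeft (fun _ : V => μ) (Equiv.swap i k)
    have h := hmp.measureReal_preimage (measurableSet_strictMaxOn B k).nullMeasurableSet
    rw [← h]
    congr 1
    ext y
    have e : ∀ v, MeasurableEquiv.piCongrLeft (fun _ : V => ℝ) (Equiv.swap i k) y v =
        y (Equiv.swap i k v) := by
      intro v
      conv_lhs => rw [show v = Equiv.swap i k (Equiv.swap i k v) by simp]
      rw [MeasurableEquiv.coe_piCongrLeft, Equiv.piCongrLeft_apply_apply]
    simp only [strictMaxOn, Set.mem_preimage, Set.mem_ofPred_eq, e, Equiv.swap_apply_right]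
    have hB : ∀ v, Equiv.swap i k v ∈ B ↔ v ∈ B := by
      intro v
      rw [Equiv.swap_apply_def]
      split_ifs with h1 h2
      · subst h1; simp [hi, hk]
      · subst h2; simp [hi, hk]
      · rfl
    constructor
    · intro H v hv hvi
      have := H (Equiv.swap i k v) ((hB v).2 hv) fun h => hvi (by
        rw [← Equiv.swap_apply_self i k v, h, Equiv.swap_apply_right])
      simpa using this
    · intro H v hv hvk
      exact H _ ((hB v).2 hv) fun h => hvk (by
        rw [← Equiv.swap_apply_self i k v, h, Equiv.swap_apply_left])
  have hdis : (B : Set V).PairwiseDisjoint fun k => strictMaxOn B k := by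
    intro a ha b hb hab
    refine Set.disjoint_left.2 fun y hya hyb => ?_
    exact lt_asymm (hya b hb (Ne.symm hab)) (hyb a ha hab)
  have hU := measureReal_biUnion_finset (μ := P) hdis fun k _ => measurableSet_strictMaxOn B k
  rw [Finset.sum_congr rfl hsym, Finset.sum_const, nsmul_eq_mul] at hU
  have hpos : (0 : ℝ) < B.card := by exact_mod_cast Finset.card_pos.2 ⟨i, hi⟩
  rw [le_div_iff₀ hpos, mul_comm, ← hU]
  exact measureReal_le_one

lemma integral_prod_of_dependsOn {E : Type*} [MeasurableSpace E] (ν : Measure E)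
    [IsProbabilityMeasure ν] {F : V → (V → E) → ℝ} (hF : ∀ i, Measurable (F i))
    {C : V → Finset V} (hC : ∀ i, DependsOn (F i) (C i : Set V)) (S : Finset V)
    (hdis : ∀ i ∈ S, ∀ k ∈ S, i ≠ k → Disjoint (C i) (C k)) :
    ∫ y, ∏ i ∈ S, F i y ∂(Measure.pi fun _ : V => ν) =
      ∏ i ∈ S, ∫ y, F i y ∂(Measure.pi fun _ : V => ν) := by
  classical
  induction S using Finset.induction_on with
  | empty => simp
  | insert a S ha ih =>
    simp only [Finset.prod_insert ha]
    rw [integral_mul_of_dependsOn ν (S := C a) (S' := S.biUnion C) (hF a)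
      (Finset.measurable_prod S fun i _ => hF i) (hC a), ih]
    · exact fun i hi k hk => hdis i (Finset.mem_insert_of_mem hi) k (Finset.mem_insert_of_mem hk)
    · intro x y hxy
      refine Finset.prod_congr rfl fun k hk => hC k fun v hv => hxy v ?_
      exact Finset.mem_coe.2 (Finset.mem_biUnion.2 ⟨k, hk, hv⟩)
    · rw [Finset.disjoint_biUnion_right]
      exact fun k hk => hdis a (Finset.mem_insert_self _ _) k (Finset.mem_insert_of_mem hk)
        fun h => ha (h ▸ hk)

variable (G : SimpleGraph V)

open Classical in
/-- The closed neighbourhood of a vertex. -/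
noncomputable def closedNbhd (i : V) : Finset V := Finset.univ.filter fun k => k = i ∨ G.Adj i k

lemma mem_closedNbhd {i k : V} : k ∈ closedNbhd G i ↔ k = i ∨ G.Adj i k := by
  simp [closedNbhd]

lemma self_mem_closedNbhd (i : V) : i ∈ closedNbhd G i := by simp [closedNbhd]

lemma mem_closedNbhd_comm {i k : V} : k ∈ closedNbhd G i ↔ i ∈ closedNbhd G k := by
  rw [mem_closedNbhd, mem_closedNbhd, G.adj_comm, eq_comm]

lemma card_closedNbhd [DecidableRel G.Adj] {d : ℕ} (hd : G.IsRegularOfDegree d) (i : V) :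
    (closedNbhd G i).card = d + 1 := by
  classical
  have : closedNbhd G i = insert i (G.neighborFinset i) := by
    ext k; simp [mem_closedNbhd]
  rw [this, Finset.card_insert_of_notMem (by simp), SimpleGraph.card_neighborFinset_eq_degree, hd i]

/-- The indicator of a local maximum, as a function on configurations. -/
noncomputable def locMax (i : V) (y : V → ℝ) : ℝ := localMaxIndicator G (fun v (y : V → ℝ) => y v) i y

lemma locMax_eq_indicator (i : V) :
    locMax G i = (strictMaxOn (closedNbhd G i) i).indicator fun _ => 1 := by
  funext y
  have : {y : V → ℝ | ∀ j, G.Adj i j → y j < y i} = strictMaxOn (closedNbhd G i) i := by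
    ext y
    simp only [strictMaxOn, Set.mem_ofPred_eq, mem_closedNbhd]
    exact ⟨fun h v hv hvi => h v (hv.resolve_left hvi), fun h v hv => h v (Or.inr hv) hv.ne'⟩
  rw [locMax, localMaxIndicator, this]

lemma locMax_eq_zero_or_one (i : V) (y : V → ℝ) : locMax G i y = 0 ∨ locMax G i y = 1 := by
  rw [locMax_eq_indicator]
  by_cases h : y ∈ strictMaxOn (closedNbhd G i) i <;> simp [h]

lemma locMax_nonneg (i : V) (y : V → ℝ) : 0 ≤ locMax G i y := by
  rcases locMax_eq_zero_or_one G i y with h | h <;> simp [h]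

lemma locMax_le_one (i : V) (y : V → ℝ) : locMax G i y ≤ 1 := by
  rcases locMax_eq_zero_or_one G i y with h | h <;> simp [h]

lemma bddMeas_locMax (i : V) : BddMeas (locMax G i) := by
  refine ⟨?_, 1, fun y => abs_le.2 ⟨by linarith [locMax_nonneg G i y], locMax_le_one G i y⟩⟩
  rw [locMax_eq_indicator]
  exact measurable_const.indicator (measurableSet_strictMaxOn _ _)

lemma dependsOn_locMax (i : V) : DependsOn (locMax G i) (closedNbhd G i : Set V) := by
  intro x y hxy
  have hi : x i = y i := hxy i (self_mem_closedNbhd G i)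
  have : x ∈ strictMaxOn (closedNbhd G i) i ↔ y ∈ strictMaxOn (closedNbhd G i) i := by
    simp only [strictMaxOn, Set.mem_ofPred_eq]
    refine forall_congr' fun v => forall_congr' fun hv => ?_
    rw [hi, hxy v hv]
  rw [locMax_eq_indicator]
  by_cases h : x ∈ strictMaxOn (closedNbhd G i) i
  · simp [h, this.1 h]
  · simp [h, mt this.2 h]

lemma locMax_mul_eq_zero {i k : V} (h : G.Adj i k) (y : V → ℝ) : locMax G i y * locMax G k y = 0 := by
  rw [locMax_eq_indicator, locMax_eq_indicator]
  by_cases h1 : y ∈ strictMaxOn (closedNbhd G i) i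
  · have : y ∉ strictMaxOn (closedNbhd G k) k := fun h2 =>
      lt_asymm (h1 k ((mem_closedNbhd G).2 (Or.inr h)) h.ne')
        (h2 i ((mem_closedNbhd G).2 (Or.inr h.symm)) h.ne)
    simp [this]
  · simp [h1]

/-- Several vertices are rarely all local maxima. -/
lemma integral_prod_locMax_le [DecidableRel G.Adj] {d : ℕ} (hd : G.IsRegularOfDegree d)
    (S : Finset V) {m : ℕ} (hm : S.card * m ≤ d) :
    ∫ y, ∏ i ∈ S, locMax G i y ∂(Measure.pi fun _ : V => μ) ≤ (1 / (m + 1 : ℝ)) ^ S.card := by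
  classical
  by_cases hS : ∃ i ∈ S, ∃ k ∈ S, G.Adj i k
  · obtain ⟨i, hi, k, hk, hik⟩ := hS
    have : ∀ y, ∏ i ∈ S, locMax G i y = 0 := by
      intro y
      rcases mul_eq_zero.1 (locMax_mul_eq_zero G hik y) with h | h
      · exact Finset.prod_eq_zero hi h
      · exact Finset.prod_eq_zero hk h
    simp only [this, integral_zero]
    positivity
  push Not at hS
  obtain ⟨E, hE, hdis⟩ := exists_disjoint_blocks (fun i => G.neighborFinset i) m S fun i _ => by
    rw [SimpleGraph.card_neighborFinset_eq_degree, hd i]; exact hm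
  -- `S` contains no edge here, so the blocks with their centres remain disjoint. A local maximum
  -- beats its own block, and these weaker events are independent.
  have hES : ∀ i ∈ S, ∀ k ∈ S, i ∉ E k := fun i hi k hk hik =>
    hS k hk i hi (by simpa using (hE k hk).1 hik)
  let C : V → Finset V := fun i => insert i (E i)
  let F : V → (V → ℝ) → ℝ := fun i => (strictMaxOn (C i) i).indicator fun _ => 1
  have hF : ∀ i, BddMeas (F i) := fun i =>
    ⟨measurable_const.indicator (measurableSet_strictMaxOn _ _), 1, fun y => by
      by_cases h : y ∈ strictMaxOn (C i) i <;> simp [F, h]⟩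
  have hC : ∀ i, DependsOn (F i) (C i : Set V) := by
    intro i x y hxy
    have hi : x i = y i := hxy i (by simp [C])
    have : x ∈ strictMaxOn (C i) i ↔ y ∈ strictMaxOn (C i) i := by
      simp only [strictMaxOn, Set.mem_ofPred_eq]
      refine forall_congr' fun v => forall_congr' fun hv => ?_
      rw [hi, hxy v hv]
    by_cases h : x ∈ strictMaxOn (C i) i
    · simp [F, h, this.1 h]
    · simp [F, h, mt this.2 h]
  have hprod := integral_prod_of_dependsOn μ (fun i => (hF i).measurable) hC S (by
    intro i hi k hk hik
    simp only [C, Finset.disjoint_insert_left, Finset.disjoint_insert_right, Finset.mem_insert,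
      not_or]
    exact ⟨⟨hik.symm, hES k hk i hi⟩, hES i hi k hk, hdis i hi k hk hik⟩)
  have hle : ∀ i ∈ S, ∀ y, locMax G i y ≤ F i y := by
    intro i hi y
    rw [locMax_eq_indicator]
    refine Set.indicator_le_indicator_of_subset ?_ (fun _ => zero_le_one) y
    intro y hy v hv hvi
    refine hy v ((mem_closedNbhd G).2 (Or.inr ?_)) hvi
    rcases Finset.mem_insert.1 hv with h | h
    · exact absurd h hvi
    · simpa using (hE i hi).1 h
  calc ∫ y, ∏ i ∈ S, locMax G i y ∂(Measure.pi fun _ : V => μ)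
      ≤ ∫ y, ∏ i ∈ S, F i y ∂(Measure.pi fun _ : V => μ) :=
        integral_mono ((BddMeas.prod S (bddMeas_locMax G)).integrable _)
          ((BddMeas.prod S hF).integrable _)
          fun y => Finset.prod_le_prod (fun i _ => locMax_nonneg G i y) fun i hi => hle i hi y
    _ = ∏ i ∈ S, ∫ y, F i y ∂(Measure.pi fun _ : V => μ) := hprod
    _ ≤ ∏ i ∈ S, (1 / (m + 1 : ℝ)) := by
        refine Finset.prod_le_prod (fun i _ => integral_nonneg fun y =>
          Set.indicator_nonneg (fun _ _ => zero_le_one) _) fun i hi => ?_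
        have h1 := measure_strictMaxOn_le μ (C i) (Finset.mem_insert_self i (E i))
        rw [Finset.card_insert_of_notMem (hES i hi i hi), (hE i hi).2] at h1
        have h2 : ∫ y, F i y ∂(Measure.pi fun _ : V => μ) =
            (Measure.pi fun _ : V => μ).real (strictMaxOn (C i) i) :=
          integral_indicator_one (measurableSet_strictMaxOn _ _)
        rw [h2]
        push_cast at h1
        exact h1
    _ = _ := by rw [Finset.prod_const]

/-- The number of local maxima in the closed neighbourhood of `j`. -/
noncomputable def locMaxNear (j : V) (y : V → ℝ) : ℝ := ∑ i ∈ closedNbhd G j, locMax G i y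

lemma bddMeas_locMaxNear (j : V) : BddMeas (locMaxNear G j) :=
  BddMeas.sum _ (bddMeas_locMax G)

lemma locMaxNear_nonneg (j : V) (y : V → ℝ) : 0 ≤ locMaxNear G j y :=
  Finset.sum_nonneg fun i _ => locMax_nonneg G i y

/-- Reduces the eighth moment to a binomial moment, that is, to joint probabilities. For `M ≥ 8`, `M
≤ 8 (M - 7)` and `(M - 7)^8` is below the falling factorial. -/
lemma pow_eight_le_choose (M : ℕ) :
    (M : ℝ) ^ 8 ≤ 8 ^ 8 * 40320 * (1 + M.choose 8) := by
  rcases lt_or_ge M 8 with h | h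
  · have h1 : (M : ℝ) ^ 8 ≤ 8 ^ 8 := by
      have : (M : ℝ) ≤ 8 := by exact_mod_cast h.le
      gcongr
    have h2 : (0 : ℝ) ≤ M.choose 8 := Nat.cast_nonneg _
    nlinarith
  · have h1 := Nat.pow_sub_le_descFactorial M 8
    rw [Nat.descFactorial_eq_factorial_mul_choose] at h1
    have h2 : M ^ 8 ≤ (8 * (M + 1 - 8)) ^ 8 := Nat.pow_le_pow_left (by omega) 8
    rw [mul_pow] at h2
    have h3 : M ^ 8 ≤ 8 ^ 8 * (Nat.factorial 8 * M.choose 8) :=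
      h2.trans (Nat.mul_le_mul_left _ h1)
    have h4 : Nat.factorial 8 = 40320 := rfl
    rw [h4] at h3
    have h5 : (M : ℝ) ^ 8 ≤ 8 ^ 8 * (40320 * M.choose 8) := by exact_mod_cast h3
    linarith

lemma locMaxNear_pow_eight_le (j : V) (y : V → ℝ) :
    locMaxNear G j y ^ 8 ≤ 8 ^ 8 * 40320 *
      (1 + ∑ S ∈ (closedNbhd G j).powersetCard 8, ∏ i ∈ S, locMax G i y) := by
  classical
  set A := (closedNbhd G j).filter fun i => locMax G i y = 1 with hA
  have h1 : locMaxNear G j y = A.card := by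
    rw [locMaxNear, hA, Finset.card_filter]
    push_cast
    refine Finset.sum_congr rfl fun i _ => ?_
    rcases locMax_eq_zero_or_one G i y with h | h <;> simp [h]
  have h2 : (A.card.choose 8 : ℝ) ≤
      ∑ S ∈ (closedNbhd G j).powersetCard 8, ∏ i ∈ S, locMax G i y := by
    rw [← Finset.card_powersetCard, Finset.cast_card]
    have hsub : A.powersetCard 8 ⊆ (closedNbhd G j).powersetCard 8 :=
      Finset.powersetCard_mono (Finset.filter_subset _ _)
    refine (Finset.sum_le_sum fun S hS => ?_).trans (Finset.sum_le_sum_of_subset_of_nonneg hsub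
      fun S _ _ => Finset.prod_nonneg fun i _ => locMax_nonneg G i y)
    rw [Finset.prod_eq_one]
    intro i hi
    exact (Finset.mem_filter.1 ((Finset.mem_powersetCard.1 hS).1 hi)).2
  rw [h1]
  refine (pow_eight_le_choose _).trans ?_
  gcongr

/-- The eighth moment of the number of local maxima in a closed neighbourhood is bounded. -/
lemma integral_locMaxNear_pow_eight_le [DecidableRel G.Adj] {d : ℕ} (hd : G.IsRegularOfDegree d)
    (j : V) : ∫ y, locMaxNear G j y ^ 8 ∂(Measure.pi fun _ : V => μ) ≤ 10 ^ 20 := by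
  classical
  set P := Measure.pi fun _ : V => μ
  have bprod : ∀ S : Finset V, BddMeas fun y => ∏ i ∈ S, locMax G i y := fun S =>
    BddMeas.prod S (bddMeas_locMax G)
  have bsum := (BddMeas.sum ((closedNbhd G j).powersetCard 8) bprod)
  -- There are at most `(d + 1)^8` sets, each of probability at most `(⌊d/8⌋ + 1)⁻⁸`. As `d + 1 ≤ 8
  -- (⌊d/8⌋ + 1)`, the dependence on `d` cancels.
  have h1 : ∑ S ∈ (closedNbhd G j).powersetCard 8, ∫ y, ∏ i ∈ S, locMax G i y ∂P ≤ 8 ^ 8 := by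
    have h2 : ∀ S ∈ (closedNbhd G j).powersetCard 8, ∫ y, ∏ i ∈ S, locMax G i y ∂P ≤
        (1 / ((d / 8 : ℕ) + 1 : ℝ)) ^ 8 := by
      intro S hS
      have hc := (Finset.mem_powersetCard.1 hS).2
      have := integral_prod_locMax_le μ G hd S (m := d / 8) (by rw [hc]; omega)
      rwa [hc] at this
    refine (Finset.sum_le_sum h2).trans ?_
    rw [Finset.sum_const, Finset.card_powersetCard, card_closedNbhd G hd, nsmul_eq_mul]
    have h3 : (((d + 1).choose 8 : ℕ) : ℝ) ≤ ((d + 1 : ℕ) : ℝ) ^ 8 := by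
      exact_mod_cast Nat.choose_le_pow (d + 1) 8
    have h4 : ((d + 1 : ℕ) : ℝ) ≤ 8 * ((d / 8 : ℕ) + 1 : ℝ) := by
      have : d + 1 ≤ 8 * (d / 8 + 1) := by omega
      exact_mod_cast this
    calc _ ≤ (8 * ((d / 8 : ℕ) + 1 : ℝ)) ^ 8 * (1 / ((d / 8 : ℕ) + 1 : ℝ)) ^ 8 := by
          gcongr
          exact h3.trans (by gcongr)
      _ = 8 ^ 8 := by
          rw [← mul_pow]; congr 1
          have : ((d / 8 : ℕ) + 1 : ℝ) ≠ 0 := by positivity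
          field_simp
  calc ∫ y, locMaxNear G j y ^ 8 ∂P
      ≤ ∫ y, 8 ^ 8 * 40320 *
        (1 + ∑ S ∈ (closedNbhd G j).powersetCard 8, ∏ i ∈ S, locMax G i y) ∂P :=
        integral_mono (((bddMeas_locMaxNear G j).pow 8).integrable P)
          ((((BddMeas.const 1).add bsum).const_mul _).integrable P) (locMaxNear_pow_eight_le G j)
    _ = 8 ^ 8 * 40320 *
        (1 + ∑ S ∈ (closedNbhd G j).powersetCard 8, ∫ y, ∏ i ∈ S, locMax G i y ∂P) := by
        rw [integral_const_mul, integral_add (integrable_const _) (bsum.integrable P),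
          integral_finsetSum _ fun S _ => (bprod S).integrable P]
        simp
    _ ≤ 8 ^ 8 * 40320 * (1 + 8 ^ 8) := by gcongr
    _ ≤ 10 ^ 20 := by norm_num

/-- The number of local maxima, as a function on configurations. -/
noncomputable def locMaxCount (y : V → ℝ) : ℝ := ∑ i, locMax G i y

lemma bddMeas_locMaxCount : BddMeas (locMaxCount G) := BddMeas.sum _ (bddMeas_locMax G)

lemma locMaxCount_sub_eq {j : V} {x y : V → ℝ} (h : ∀ v, v ≠ j → x v = y v) :
    locMaxCount G x - locMaxCount G y =
      ∑ i ∈ closedNbhd G j, (locMax G i x - locMax G i y) := by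
  rw [locMaxCount, locMaxCount, ← Finset.sum_sub_distrib]
  refine (Finset.sum_subset (Finset.subset_univ _) fun i _ hi => ?_).symm
  rw [dependsOn_locMax G i fun v hv => h v ?_, sub_self]
  rintro rfl
  exact hi ((mem_closedNbhd_comm G).1 hv)

lemma locMaxCount_sub_pow_eight_le {j : V} {x y : V → ℝ} (h : ∀ v, v ≠ j → x v = y v) :
    (locMaxCount G x - locMaxCount G y) ^ 8 ≤
      128 * (locMaxNear G j x ^ 8 + locMaxNear G j y ^ 8) := by
  have h1 : |locMaxCount G x - locMaxCount G y| ≤ locMaxNear G j x + locMaxNear G j y := by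
    have h0 := locMaxNear_nonneg G j x
    have h2 := locMaxNear_nonneg G j y
    rw [locMaxCount_sub_eq G h, Finset.sum_sub_distrib]
    change |locMaxNear G j x - locMaxNear G j y| ≤ _
    rw [abs_le]; constructor <;> linarith
  rw [← Even.pow_abs (by decide : Even 8)]
  refine (pow_le_pow_left₀ (abs_nonneg _) h1 8).trans ?_
  have := add_pow_le (locMaxNear_nonneg G j x) (locMaxNear_nonneg G j y) 8
  norm_num at this
  exact this

end LocalMax

/-! ### Two independent copies and swaps -/

section Swap

variable {V : Type*} [Fintype V] (μ : Measure ℝ) [IsProbabilityMeasure μ]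

open Classical in
/-- Take the second copy on `A` and the first one elsewhere. -/
noncomputable def mix (A : Set V) (y : V → ℝ × ℝ) (v : V) : ℝ :=
  if v ∈ A then (y v).2 else (y v).1

open Classical in
/-- Exchange the two copies at `j`. -/
noncomputable def swapAt (j : V) (y : V → ℝ × ℝ) (v : V) : ℝ × ℝ :=
  if v = j then (y v).swap else y v

lemma measurePreserving_mix (A : Set V) :
    MeasurePreserving (mix A) (Measure.pi fun _ : V => μ.prod μ) (Measure.pi fun _ : V => μ) := by
  classical
  refine measurePreserving_pi (fun _ : V => μ.prod μ) (fun _ : V => μ)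
    (f := fun v (p : ℝ × ℝ) => if v ∈ A then p.2 else p.1) fun v => ?_
  by_cases h : v ∈ A
  · simpa [h] using measurePreserving_snd (μ := μ) (ν := μ)
  · simpa [h] using measurePreserving_fst (μ := μ) (ν := μ)

lemma measurePreserving_swapAt (j : V) :
    MeasurePreserving (swapAt j) (Measure.pi fun _ : V => μ.prod μ)
      (Measure.pi fun _ : V => μ.prod μ) := by
  classical
  refine measurePreserving_pi (fun _ : V => μ.prod μ) (fun _ : V => μ.prod μ)
    (f := fun v (p : ℝ × ℝ) => if v = j then p.swap else p) fun v => ?_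
  by_cases h : v = j
  · simpa [h] using Measure.measurePreserving_swap (μ := μ) (ν := μ)
  · simp only [h, if_false]
    exact MeasurePreserving.id (μ.prod μ)

lemma swapAt_swapAt (j : V) (y : V → ℝ × ℝ) : swapAt j (swapAt j y) = y := by
  funext v
  by_cases h : v = j <;> simp [swapAt, h]

/-- The swap at `j` interchanges the two configurations that define an increment, hence its oddness.
-/
lemma mix_swapAt (A : Set V) {j : V} (hj : j ∉ A) (y : V → ℝ × ℝ) :
    mix A (swapAt j y) = mix (insert j A) y := by
  classical
  funext v
  by_cases h : v = j
  · subst h; simp [mix, swapAt, hj]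
  · simp [mix, swapAt, h]

lemma mix_insert_of_ne (A : Set V) {j v : V} (h : v ≠ j) (y : V → ℝ × ℝ) :
    mix A y v = mix (insert j A) y v := by
  have : v ∈ insert j A ↔ v ∈ A := by simp [h]
  by_cases hv : v ∈ A
  · simp [mix, hv, this.2 hv]
  · simp [mix, hv, mt this.1 hv]

lemma mix_congr (A : Set V) {x y : V → ℝ × ℝ} {v : V} (h : x v = y v) :
    mix A x v = mix A y v := by
  simp [mix, h]

lemma integral_mix_univ_mul_mix_empty (f g : (V → ℝ) → ℝ) :
    ∫ y, f (mix Set.univ y) * g (mix ∅ y) ∂(Measure.pi fun _ : V => μ.prod μ) =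
      (∫ x, f x ∂(Measure.pi fun _ : V => μ)) * ∫ x, g x ∂(Measure.pi fun _ : V => μ) := by
  have hmp := measurePreserving_arrowProdEquivProdArrow ℝ ℝ V (fun _ => μ) (fun _ => μ)
  have h := hmp.integral_comp' (g := fun p : (V → ℝ) × (V → ℝ) => g p.1 * f p.2)
  rw [integral_prod_mul] at h
  rw [mul_comm, ← h]
  congr 1; funext y
  have h1 : mix Set.univ y = fun v => (y v).2 := by funext v; simp [mix]
  have h2 : mix ∅ y = fun v => (y v).1 := by funext v; simp [mix]
  rw [h1, h2, mul_comm]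
  rfl

variable (G : SimpleGraph V)

lemma integral_comp_mix (A : Set V) {f : (V → ℝ) → ℝ} (hf : BddMeas f) :
    ∫ y, f (mix A y) ∂(Measure.pi fun _ : V => μ.prod μ) =
      ∫ x, f x ∂(Measure.pi fun _ : V => μ) := by
  rw [← (measurePreserving_mix μ A).map_eq, integral_map
    (measurePreserving_mix μ A).measurable.aemeasurable hf.measurable.aestronglyMeasurable]

/-- Increment of the number of local maxima when the coordinate `j` is resampled. -/
noncomputable def incr (A : Set V) (j : V) (y : V → ℝ × ℝ) : ℝ :=
  locMaxCount G (mix A y) - locMaxCount G (mix (insert j A) y)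

lemma bddMeas_comp_mix (A : Set V) {f : (V → ℝ) → ℝ} (hf : BddMeas f) :
    BddMeas fun y : V → ℝ × ℝ => f (mix A y) :=
  -- The Dirac mass is a dummy; only the measurability of `mix` is used.
  hf.comp (measurePreserving_mix (Measure.dirac (0 : ℝ)) A).measurable

lemma bddMeas_incr (A : Set V) (j : V) : BddMeas (incr G A j) :=
  (bddMeas_comp_mix A (bddMeas_locMaxCount G)).sub
    (bddMeas_comp_mix (insert j A) (bddMeas_locMaxCount G))

lemma integral_incr_pow_eight_le [DecidableRel G.Adj] {d : ℕ} (hd : G.IsRegularOfDegree d)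
    (A : Set V) (j : V) :
    ∫ y, incr G A j y ^ 8 ∂(Measure.pi fun _ : V => μ.prod μ) ≤ 256 * 10 ^ 20 := by
  have b := (bddMeas_locMaxNear G j).pow 8
  have b1 := bddMeas_comp_mix A b
  have b2 := bddMeas_comp_mix (insert j A) b
  refine (integral_mono (((bddMeas_incr G A j).pow 8).integrable _)
    (((b1.add b2).const_mul 128).integrable _) fun y =>
      locMaxCount_sub_pow_eight_le G (j := j) fun v hv => mix_insert_of_ne A hv y).trans ?_
  rw [integral_const_mul, integral_add (b1.integrable _) (b2.integrable _),
    integral_comp_mix μ A b, integral_comp_mix μ (insert j A) b]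
  have := integral_locMaxNear_pow_eight_le μ G hd j
  linarith

open Classical in
/-- The closed ball of radius two. -/
noncomputable def closedNbhd₂ (j : V) : Finset V := (closedNbhd G j).biUnion (closedNbhd G)

lemma dependsOn_incr (A : Set V) (j : V) : DependsOn (incr G A j) (closedNbhd₂ G j : Set V) := by
  classical
  intro x y hxy
  have e : ∀ z, incr G A j z = ∑ i ∈ closedNbhd G j,
      (locMax G i (mix A z) - locMax G i (mix (insert j A) z)) := fun z =>
    locMaxCount_sub_eq G fun v hv => mix_insert_of_ne A hv z
  rw [e, e]
  refine Finset.sum_congr rfl fun i hi => ?_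
  have h : ∀ v ∈ (closedNbhd G i : Set V), x v = y v := fun v hv =>
    hxy v (Finset.mem_coe.2 (Finset.mem_biUnion.2 ⟨i, hi, hv⟩))
  rw [dependsOn_locMax G i fun v hv => mix_congr A (h v hv),
    dependsOn_locMax G i fun v hv => mix_congr (insert j A) (h v hv)]

/-- Balls of radius two meet only when their centres are within distance four, reached by four
passages to closed neighbours. -/
lemma card_not_disjoint_closedNbhd₂_le [DecidableRel G.Adj] {d : ℕ} (hd : G.IsRegularOfDegree d)
    (j : V) [DecidablePred fun k => ¬Disjoint (closedNbhd₂ G j) (closedNbhd₂ G k)] :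
    (Finset.univ.filter fun k => ¬Disjoint (closedNbhd₂ G j) (closedNbhd₂ G k)).card ≤
      (d + 1) ^ 4 := by
  classical
  have hsub : (Finset.univ.filter fun k => ¬Disjoint (closedNbhd₂ G j) (closedNbhd₂ G k)) ⊆
      (((closedNbhd G j).biUnion (closedNbhd G)).biUnion (closedNbhd G)).biUnion
        (closedNbhd G) := by
    intro k hk
    obtain ⟨v, hv1, hv2⟩ := Finset.not_disjoint_iff.1 (Finset.mem_filter.1 hk).2
    obtain ⟨i, hi, hiv⟩ := Finset.mem_biUnion.1 hv2
    exact Finset.mem_biUnion.2 ⟨i, Finset.mem_biUnion.2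
      ⟨v, hv1, (mem_closedNbhd_comm G).1 hiv⟩, (mem_closedNbhd_comm G).1 hi⟩
  have hstep : ∀ s : Finset V, (s.biUnion (closedNbhd G)).card ≤ s.card * (d + 1) := fun s =>
    Finset.card_biUnion_le_card_mul _ _ _ fun i _ => (card_closedNbhd G hd i).le
  calc _ ≤ _ := Finset.card_le_card hsub
    _ ≤ _ := hstep _
    _ ≤ _ := Nat.mul_le_mul_right _ (hstep _)
    _ ≤ _ := Nat.mul_le_mul_right _ (Nat.mul_le_mul_right _ (hstep _))
    _ = (d + 1) ^ 4 := by rw [card_closedNbhd G hd]; ring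

/-- The vertices numbered below `k`. -/
def initialVertices (V : Type*) [Fintype V] (k : ℕ) : Set V :=
  {v | (Fintype.equivFin V v : ℕ) < k}

lemma insert_initialVertices (j : V) :
    insert j (initialVertices V (Fintype.equivFin V j)) =
      initialVertices V (Fintype.equivFin V j + 1) := by
  ext v
  simp only [initialVertices, Set.mem_insert_iff, Set.mem_ofPred_eq, Nat.lt_succ_iff_lt_or_eq]
  rw [or_comm, Fin.val_inj, (Fintype.equivFin V).apply_eq_iff_eq]

lemma notMem_initialVertices (j : V) : j ∉ initialVertices V (Fintype.equivFin V j) := by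
  simp [initialVertices]

/-- The normalized number of local maxima. -/
noncomputable def normCount (m σ : ℝ) (y : V → ℝ × ℝ) : ℝ := (locMaxCount G (mix ∅ y) - m) / σ

/-- The normalized increments along the numbering of the vertices. -/
noncomputable def normIncr (σ : ℝ) (j : V) (y : V → ℝ × ℝ) : ℝ :=
  incr G (initialVertices V (Fintype.equivFin V j)) j y / σ

lemma sum_normIncr (σ : ℝ) (y : V → ℝ × ℝ) :
    ∑ j, normIncr G σ j y = (locMaxCount G (mix ∅ y) - locMaxCount G (mix Set.univ y)) / σ := by
  let F : ℕ → ℝ := fun k => locMaxCount G (mix (initialVertices V k) y)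
  have h1 : ∑ j, normIncr G σ j y = (∑ j, (F (Fintype.equivFin V j) -
      F (Fintype.equivFin V j + 1))) / σ := by
    rw [Finset.sum_div]
    refine Finset.sum_congr rfl fun j _ => ?_
    rw [normIncr, incr, insert_initialVertices]
  rw [h1, (Fintype.equivFin V).sum_comp (fun k : Fin (Fintype.card V) => F k - F (k + 1)),
    Fin.sum_univ_eq_sum_range (fun k => F k - F (k + 1)), Finset.sum_range_sub']
  have h0 : initialVertices V 0 = ∅ := by ext; simp [initialVertices]
  have hn : initialVertices V (Fintype.card V) = Set.univ := by ext; simp [initialVertices]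
  simp only [F, h0, hn]

/-- The increments telescope to the difference between the two copies. In `E W g(W)` the mean `m`
may be replaced by the count of the second copy, which is independent of `W`. -/
lemma swapCoupling_locMax {m σ : ℝ} (hm : m = ∫ x, locMaxCount G x ∂(Measure.pi fun _ : V => μ)) :
    SwapCoupling (Measure.pi fun _ : V => μ.prod μ) (normCount G m σ) (normIncr G σ) swapAt where
  bddW := ((bddMeas_comp_mix ∅ (bddMeas_locMaxCount G)).sub (BddMeas.const m)).div_const σ
  bddD j := (bddMeas_incr G _ j).div_const σ
  mp := measurePreserving_swapAt μ
  invol := swapAt_swapAt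
  anti j y := by
    have hj := notMem_initialVertices j
    have h1 := mix_swapAt _ hj y
    have h2 := mix_swapAt _ hj (swapAt j y)
    rw [swapAt_swapAt] at h2
    rw [normIncr, normIncr, incr, incr, h1, ← h2]
    ring
  identity g hg := by
    have bf := bddMeas_locMaxCount G
    have b0 := bddMeas_comp_mix ∅ bf
    have b1 := bddMeas_comp_mix Set.univ bf
    -- Regularity on a single copy is recovered by pulling back along the diagonal.
    have bg' : BddMeas fun x : V → ℝ => g ((locMaxCount G x - m) / σ) := by
      have hmeas : Measurable fun x : V → ℝ => fun v => (x v, x v) :=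
        measurable_pi_iff.2 fun v => (measurable_pi_apply v).prodMk (measurable_pi_apply v)
      have := hg.comp hmeas
      have e : ∀ x : V → ℝ, mix ∅ (fun v => (x v, x v)) = x := fun x => by
        funext v; simp [mix]
      simpa only [normCount, e] using this
    set P := Measure.pi fun _ : V => μ.prod μ
    have key := integral_mix_univ_mul_mix_empty μ (locMaxCount G)
      fun x => g ((locMaxCount G x - m) / σ)
    have hconst : ∫ y, m * g (normCount G m σ y) ∂P =
        ∫ y, locMaxCount G (mix Set.univ y) * g (normCount G m σ y) ∂P := by
      rw [integral_const_mul]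
      have h2 := integral_comp_mix μ (∅ : Set V) bg'
      change _ = ∫ y, locMaxCount G (mix Set.univ y) *
        g ((locMaxCount G (mix ∅ y) - m) / σ) ∂P
      rw [key, ← hm, ← h2]
      rfl
    have hD : ∀ j, BddMeas (normIncr G σ j) := fun j => (bddMeas_incr G _ j).div_const σ
    rw [← integral_finsetSum _ fun j _ => ((hD j).mul hg).integrable P]
    simp only [← Finset.sum_mul, sum_normIncr]
    have e1 : ∫ y, normCount G m σ y * g (normCount G m σ y) ∂P =
        (∫ y, locMaxCount G (mix ∅ y) * g (normCount G m σ y) ∂P -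
          ∫ y, m * g (normCount G m σ y) ∂P) / σ := by
      rw [← integral_sub ((b0.mul hg).integrable P) ((hg.const_mul m).integrable P),
        ← integral_div]
      congr 1; funext y
      simp only [normCount]; ring
    rw [e1, hconst, ← integral_sub ((b0.mul hg).integrable P) ((b1.mul hg).integrable P),
      ← integral_div]
    congr 1; funext y
    ring

lemma diff_normCount (m σ : ℝ) (j : V) (y : V → ℝ × ℝ) :
    SwapCoupling.diff (normCount G m σ) swapAt j y = incr G ∅ j y / σ := by
  rw [SwapCoupling.diff, normCount, normCount, mix_swapAt ∅ (Set.notMem_empty j), incr]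
  ring

lemma integral_normCount_sq {m σ : ℝ} (hσ : 0 < σ)
    (hm : m = ∫ x, locMaxCount G x ∂(Measure.pi fun _ : V => μ))
    (hv : variance (locMaxCount G) (Measure.pi fun _ : V => μ) = σ ^ 2) :
    ∫ y, normCount G m σ y ^ 2 ∂(Measure.pi fun _ : V => μ.prod μ) = 1 := by
  have bf := bddMeas_locMaxCount G
  have h := integral_comp_mix μ (∅ : Set V) (((bf.sub (BddMeas.const m)).div_const σ).pow 2)
  rw [variance_eq_integral bf.measurable.aemeasurable, ← hm] at hv
  change ∫ y, ((locMaxCount G (mix ∅ y) - m) / σ) ^ 2 ∂_ = 1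
  rw [h]
  simp only [div_pow]
  rw [integral_div, hv, div_self (by positivity)]

end Swap

/-! ### Moment estimates for the coupling of local maxima -/

section Moments

variable {V : Type*} [Fintype V] (μ : Measure ℝ) [IsProbabilityMeasure μ] (G : SimpleGraph V)
  [DecidableRel G.Adj] {d : ℕ}

open SwapCoupling

/-- Fourth central moment of a sum of functions depending on balls of radius two. -/
lemma integral_sum_closedNbhd₂_pow_four_le (hd : G.IsRegularOfDegree d) [Nonempty V]
    {T : V → (V → ℝ × ℝ) → ℝ} (hT : ∀ j, BddMeas (T j))
    (hS : ∀ j, DependsOn (T j) (closedNbhd₂ G j : Set V)) {K : ℝ} (hK0 : 0 ≤ K)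
    (hK : ∀ j, ∫ y, T j y ^ 4 ∂(Measure.pi fun _ : V => μ.prod μ) ≤ K) :
    ∫ y, (∑ j, T j y - ∑ j, ∫ y, T j y ∂(Measure.pi fun _ : V => μ.prod μ)) ^ 4
      ∂(Measure.pi fun _ : V => μ.prod μ) ≤
      31 * (Fintype.card V) ^ 2 * ((d + 1 : ℝ) ^ 4) ^ 2 * (16 * K) := by
  classical
  have hn : (1 : ℝ) ≤ Fintype.card V := by exact_mod_cast Fintype.card_pos
  have hd1 : (1 : ℝ) ≤ (d + 1 : ℝ) ^ 4 := one_le_pow₀ (by linarith [(Nat.cast_nonneg d : (0:ℝ) ≤ d)])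
  -- The minimum meets the requirement that the dependency size not exceed the number of vertices.
  have hpos : (0 : ℝ) < min (Fintype.card V : ℝ) ((d + 1 : ℝ) ^ 4) :=
    lt_min (by linarith) (by linarith)
  have h := integral_sum_sub_pow_four_le (μ.prod μ) hT (S := closedNbhd₂ G)
    (B := fun j => Finset.univ.filter fun k => ¬Disjoint (closedNbhd₂ G j) (closedNbhd₂ G k)) hS
    (fun j k hk => by simpa using hk) (d := min (Fintype.card V : ℝ) ((d + 1 : ℝ) ^ 4)) hpos
    (min_le_left _ _) (fun j => le_min (by exact_mod_cast Finset.card_le_univ _)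
      (by exact_mod_cast card_not_disjoint_closedNbhd₂_le G hd j)) hK
  refine h.trans ?_
  gcongr
  exact min_le_right _ _

/-- The fourth power of a product of two increments is what calls for eighth moments: `2 a⁴ b⁴ ≤ a⁸
+ b⁸`. -/
lemma integral_mul_incr_pow_four_le (hd : G.IsRegularOfDegree d) {σ : ℝ} (hσ : 0 < σ)
    (A B : Set V) (j : V) :
    ∫ y, (incr G A j y / σ * (incr G B j y / σ) / 2) ^ 4 ∂(Measure.pi fun _ : V => μ.prod μ) ≤
      16 * 10 ^ 20 / σ ^ 8 := by
  have ba := (bddMeas_incr G A j).pow 8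
  have bb := (bddMeas_incr G B j).pow 8
  have hA := integral_incr_pow_eight_le μ G hd A j
  have hB := integral_incr_pow_eight_le μ G hd B j
  calc _ ≤ ∫ y, (incr G A j y ^ 8 + incr G B j y ^ 8) / (32 * σ ^ 8)
        ∂(Measure.pi fun _ : V => μ.prod μ) := by
        refine integral_mono (BddMeas.integrable ((((((bddMeas_incr G A j).div_const σ).mul
          ((bddMeas_incr G B j).div_const σ))).div_const 2).pow 4) _)
          (((ba.add bb).div_const _).integrable _) fun y => ?_
        simp only
        set a := incr G A j y
        set b := incr G B j y
        have e : (a / σ * (b / σ) / 2) ^ 4 = (2 * (a ^ 4 * b ^ 4)) / (32 * σ ^ 8) := by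
          field_simp; norm_num
        rw [e]
        gcongr
        nlinarith [sq_nonneg (a ^ 4 - b ^ 4)]
    _ = (∫ y, incr G A j y ^ 8 ∂(Measure.pi fun _ : V => μ.prod μ) +
        ∫ y, incr G B j y ^ 8 ∂(Measure.pi fun _ : V => μ.prod μ)) / (32 * σ ^ 8) := by
        rw [integral_div, integral_add (ba.integrable _) (bb.integrable _)]
    _ ≤ (256 * 10 ^ 20 + 256 * 10 ^ 20) / (32 * σ ^ 8) := by gcongr
    _ = _ := by field_simp; norm_num

/-- Mixed moments of order at most eight of two increments. -/
lemma integral_mixed_incr_le (hd : G.IsRegularOfDegree d) (A B : Set V) (j : V)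
    {F : ℝ → ℝ → ℝ} (hF : BddMeas fun y => F (incr G A j y) (incr G B j y))
    (hle : ∀ a b, F a b ≤ 1 + a ^ 8 + b ^ 8) :
    ∫ y, F (incr G A j y) (incr G B j y) ∂(Measure.pi fun _ : V => μ.prod μ) ≤ 10 ^ 24 := by
  have ba := (bddMeas_incr G A j).pow 8
  have bb := (bddMeas_incr G B j).pow 8
  have hA := integral_incr_pow_eight_le μ G hd A j
  have hB := integral_incr_pow_eight_le μ G hd B j
  refine (integral_mono (hF.integrable _) ((((BddMeas.const 1).add ba).add bb).integrable _)
    fun y => hle _ _).trans ?_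
  rw [integral_add (((BddMeas.const 1).add ba).integrable _) (bb.integrable _),
    integral_add (integrable_const _) (ba.integrable _)]
  simp only [integral_const, probReal_univ, smul_eq_mul]
  norm_num at hA hB ⊢
  linarith

lemma integral_gain_eq_one {m σ : ℝ} (hσ : 0 < σ)
    (hm : m = ∫ x, locMaxCount G x ∂(Measure.pi fun _ : V => μ))
    (hv : variance (locMaxCount G) (Measure.pi fun _ : V => μ) = σ ^ 2) :
    ∫ y, gain (normCount G m σ) (normIncr G σ) swapAt y ∂(Measure.pi fun _ : V => μ.prod μ) = 1 := by
  have hc := swapCoupling_locMax μ G (σ := σ) hm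
  have h := hc.integral_mul_eq (g := fun w => w) hc.bddW
  rw [← integral_normCount_sq μ G hσ hm hv]
  simp only [sq]
  rw [h]
  rfl

/-- Source of the factor `d²`: with dependency size `d⁴` the sum fluctuates on the scale `√(n d⁴) /
σ²`. -/
lemma fourth_moment_const_le (hd1 : 1 ≤ d) {σ n : ℝ} (hσ : 0 < σ) (hn : 0 ≤ n) :
    31 * n ^ 2 * ((d + 1 : ℝ) ^ 4) ^ 2 * (16 * (16 * 10 ^ 20 / σ ^ 8)) ≤
      (10 ^ 7 * d ^ 2 * √n / σ ^ 2) ^ 4 := by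
  have h1 : (1 : ℝ) ≤ d := by exact_mod_cast hd1
  have h2 : (d + 1 : ℝ) ^ 8 ≤ (2 * d) ^ 8 := by gcongr; linarith
  have h3 : √n ^ 4 = n ^ 2 := by
    rw [show √n ^ 4 = (√n ^ 2) ^ 2 by ring, Real.sq_sqrt hn]
  calc 31 * n ^ 2 * ((d + 1 : ℝ) ^ 4) ^ 2 * (16 * (16 * 10 ^ 20 / σ ^ 8))
      = 31 * n ^ 2 * (d + 1 : ℝ) ^ 8 * (16 * (16 * 10 ^ 20)) / σ ^ 8 := by ring
    _ ≤ 31 * n ^ 2 * (2 * d) ^ 8 * (16 * (16 * 10 ^ 20)) / σ ^ 8 := by gcongr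
    _ ≤ 10 ^ 28 * n ^ 2 * d ^ 8 / σ ^ 8 := by
        refine div_le_div_of_nonneg_right ?_ (by positivity)
        have : 0 ≤ n ^ 2 * (d : ℝ) ^ 8 := by positivity
        rw [mul_pow]
        linarith
    _ = _ := by rw [div_pow, mul_pow, mul_pow, h3]; ring

variable {G}

lemma integral_one_sub_gain_pow_four_le (hd : G.IsRegularOfDegree d) (hd1 : 1 ≤ d) [Nonempty V]
    {m σ : ℝ} (hσ : 0 < σ)
    (hm : m = ∫ x, locMaxCount G x ∂(Measure.pi fun _ : V => μ))
    (hv : variance (locMaxCount G) (Measure.pi fun _ : V => μ) = σ ^ 2) :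
    ∫ y, (1 - gain (normCount G m σ) (normIncr G σ) swapAt y) ^ 4
      ∂(Measure.pi fun _ : V => μ.prod μ) ≤
      (10 ^ 7 * d ^ 2 * √(Fintype.card V : ℝ) / σ ^ 2) ^ 4 := by
  have hc := swapCoupling_locMax μ G (σ := σ) hm
  have bT : ∀ j, BddMeas fun y =>
      normIncr G σ j y * SwapCoupling.diff (normCount G m σ) swapAt j y / 2 := fun j =>
    ((hc.bddD j).mul (hc.bdd_diff j)).div_const 2
  have h := integral_sum_closedNbhd₂_pow_four_le μ G hd bT (fun j x y hxy => by
      simp only [diff_normCount, normIncr, dependsOn_incr G _ j hxy])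
    (K := 16 * 10 ^ 20 / σ ^ 8) (by positivity) (fun j => by
      simp only [diff_normCount, normIncr]
      exact integral_mul_incr_pow_four_le μ G hd hσ _ _ j)
  rw [← integral_finsetSum _ fun j _ => (bT j).integrable _] at h
  have h1 := integral_gain_eq_one μ G hσ hm hv
  simp only [gain] at h1
  rw [h1] at h
  refine (le_of_eq ?_).trans (h.trans (fourth_moment_const_le hd1 hσ (Nat.cast_nonneg _)))
  congr 1; funext y
  rw [gain, ← neg_sub, Even.neg_pow (by decide)]

lemma integral_absGain_pow_four_le (hd : G.IsRegularOfDegree d) (hd1 : 1 ≤ d) [Nonempty V]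
    {m σ : ℝ} (hσ : 0 < σ)
    (hm : m = ∫ x, locMaxCount G x ∂(Measure.pi fun _ : V => μ)) :
    ∫ y, absGain (normCount G m σ) (normIncr G σ) swapAt y ^ 4
      ∂(Measure.pi fun _ : V => μ.prod μ) ≤
      (10 ^ 7 * d ^ 2 * √(Fintype.card V : ℝ) / σ ^ 2) ^ 4 := by
  have hc := swapCoupling_locMax μ G (σ := σ) hm
  have bT : ∀ j, BddMeas fun y =>
      |normIncr G σ j y| * SwapCoupling.diff (normCount G m σ) swapAt j y / 2 := fun j =>
    ((hc.bddD j).abs.mul (hc.bdd_diff j)).div_const 2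
  have h := integral_sum_closedNbhd₂_pow_four_le μ G hd bT (fun j x y hxy => by
      simp only [diff_normCount, normIncr, dependsOn_incr G _ j hxy])
    (K := 16 * 10 ^ 20 / σ ^ 8) (by positivity) (fun j => by
      refine (le_of_eq ?_).trans (integral_mul_incr_pow_four_le μ G hd hσ
        (initialVertices V (Fintype.equivFin V j)) ∅ j)
      congr 1; funext y
      simp only [diff_normCount, normIncr]
      rw [div_pow, mul_pow, Even.pow_abs (by decide), ← mul_pow, ← div_pow])
  rw [← integral_finsetSum _ fun j _ => (bT j).integrable _] at h
  have h1 := hc.integral_absGain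
  simp only [absGain] at h1
  rw [h1] at h
  simp only [sub_zero] at h
  exact h.trans (fourth_moment_const_le hd1 hσ (Nat.cast_nonneg _))

/-- The variance of the number of local maxima is at most linear in the number of vertices. -/
lemma sq_le_card (hd : G.IsRegularOfDegree d) {m σ : ℝ} (hσ : 0 < σ)
    (hm : m = ∫ x, locMaxCount G x ∂(Measure.pi fun _ : V => μ))
    (hv : variance (locMaxCount G) (Measure.pi fun _ : V => μ) = σ ^ 2) :
    σ ^ 2 ≤ 10 ^ 24 * Fintype.card V := by
  have hc := swapCoupling_locMax μ G (σ := σ) hm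
  have h1 := integral_gain_eq_one μ G hσ hm hv
  simp only [gain] at h1
  rw [integral_finsetSum _ fun j _ => (((hc.bddD j).mul (hc.bdd_diff j)).div_const 2).integrable _]
    at h1
  -- `E T = 1` is a sum of `n` terms, each of size `O(σ⁻²)`.
  have h2 : ∀ j : V, ∫ y, normIncr G σ j y * SwapCoupling.diff (normCount G m σ) swapAt j y / 2
      ∂(Measure.pi fun _ : V => μ.prod μ) ≤ 10 ^ 24 / σ ^ 2 := by
    intro j
    have := integral_mixed_incr_le μ G hd (initialVertices V (Fintype.equivFin V j)) ∅ j
      (F := fun a b => a * b / 2) (((bddMeas_incr G _ j).mul (bddMeas_incr G _ j)).div_const 2)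
      fun a b => by
        nlinarith [sq_nonneg (a - b), sq_nonneg (a ^ 2 - 1 / 2), sq_nonneg (b ^ 2 - 1 / 2),
          sq_nonneg (a ^ 4 - 1 / 2), sq_nonneg (b ^ 4 - 1 / 2)]
    have e : ∀ y, normIncr G σ j y * SwapCoupling.diff (normCount G m σ) swapAt j y / 2 =
        (incr G (initialVertices V (Fintype.equivFin V j)) j y * incr G ∅ j y / 2) / σ ^ 2 := by
      intro y
      rw [diff_normCount, normIncr]; field_simp
    simp only [e]
    rw [integral_div]
    gcongr
  have h3 := Finset.sum_le_sum fun j (_ : j ∈ Finset.univ) => h2 j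
  rw [h1, Finset.sum_const, Finset.card_univ, nsmul_eq_mul, mul_div_assoc',
    le_div_iff₀ (by positivity)] at h3
  linarith

lemma integral_normCount_pow_four_le (hd : G.IsRegularOfDegree d) (hd1 : 1 ≤ d) [Nonempty V]
    {m σ : ℝ} (hσ : 0 < σ)
    (hm : m = ∫ x, locMaxCount G x ∂(Measure.pi fun _ : V => μ))
    (hv : variance (locMaxCount G) (Measure.pi fun _ : V => μ) = σ ^ 2) :
    ∫ y, normCount G m σ y ^ 4 ∂(Measure.pi fun _ : V => μ.prod μ) ≤
      6 + 9 * (10 ^ 7 * d ^ 2 * √(Fintype.card V : ℝ) / σ ^ 2) ^ 2 +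
      Fintype.card V * (3 / 2 * (1 + 10 ^ 24) * σ⁻¹ ^ 3 + 10 ^ 24 * σ⁻¹ ^ 4) := by
  have hn : (0 : ℝ) < Fintype.card V := by exact_mod_cast Fintype.card_pos
  have hd0 : (0 : ℝ) < d := by exact_mod_cast hd1
  have hc := swapCoupling_locMax μ G (σ := σ) hm
  refine hc.fourth_moment_le (by positivity) (by positivity)
    (integral_normCount_sq μ G hσ hm hv).le (integral_one_sub_gain_pow_four_le μ hd hd1 hσ hm hv)
    (fun j => ?_) fun j => ?_
  · have := integral_mixed_incr_le μ G hd (initialVertices V (Fintype.equivFin V j)) ∅ j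
      (F := fun a b => a ^ 2 * b ^ 4)
      (((bddMeas_incr G _ j).pow 2).mul ((bddMeas_incr G _ j).pow 4))
      fun a b => by
        nlinarith [sq_nonneg (a ^ 2 - b ^ 4), sq_nonneg (a ^ 4 - 1), sq_nonneg (b ^ 4)]
    have e : ∀ y, normIncr G σ j y ^ 2 * SwapCoupling.diff (normCount G m σ) swapAt j y ^ 4 =
        (incr G (initialVertices V (Fintype.equivFin V j)) j y ^ 2 * incr G ∅ j y ^ 4) *
          σ⁻¹ ^ 6 := by
      intro y
      rw [diff_normCount, normIncr]; field_simp
    simp only [e]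
    rw [integral_mul_const]
    gcongr
  · have := integral_mixed_incr_le μ G hd (initialVertices V (Fintype.equivFin V j)) ∅ j
      (F := fun a b => |a| * |b| ^ 3)
      ((bddMeas_incr G _ j).abs.mul ((bddMeas_incr G _ j).abs.pow 3))
      fun a b => by
        have ha : a ^ 8 = |a| ^ 8 := (Even.pow_abs (by decide) a).symm
        have hb : b ^ 8 = |b| ^ 8 := (Even.pow_abs (by decide) b).symm
        rw [ha, hb]
        set u := |a|
        set v := |b|
        have h1 : u * v ^ 3 ≤ (u ^ 2 * v ^ 2 + v ^ 4) / 2 := by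
          nlinarith [sq_nonneg (v * (u - v))]
        nlinarith [sq_nonneg (u ^ 2 - v ^ 2), sq_nonneg (u ^ 4 - 1), sq_nonneg (v ^ 4 - 1),
          sq_nonneg (u ^ 4), sq_nonneg (v ^ 4)]
    have e : ∀ y, |normIncr G σ j y| * |SwapCoupling.diff (normCount G m σ) swapAt j y| ^ 3 =
        (|incr G (initialVertices V (Fintype.equivFin V j)) j y| * |incr G ∅ j y| ^ 3) *
          σ⁻¹ ^ 4 := by
      intro y
      rw [diff_normCount, normIncr, abs_div, abs_div, abs_of_pos hσ]; field_simp
    simp only [e]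
    rw [integral_mul_const]
    gcongr

end Moments

/-! ### Crude tail bounds and assembly -/

/-- For `|z| ≥ 1` both tails beyond `|z|` are small, by Markov's inequality for `|W|³` and by
Gaussian decay. It serves when the error parameter exceeds one. -/
lemma one_add_pow_three_mul_le {Ω : Type*} [MeasurableSpace Ω] (P : Measure Ω)
    [IsProbabilityMeasure P] {W : Ω → ℝ} (hW : BddMeas W) (z : ℝ) :
    (1 + |z|) ^ 3 * |P.real {ω | W ω ≤ z} - stdNormalCDF z| ≤
      128 + 8 * ∫ ω, |W ω| ^ 3 ∂P := by
  have h3 : 0 ≤ ∫ ω, |W ω| ^ 3 ∂P := integral_nonneg fun ω => by positivity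
  have p0 : 0 ≤ P.real {ω | W ω ≤ z} := measureReal_nonneg
  have p1 : P.real {ω | W ω ≤ z} ≤ 1 := measureReal_le_one
  have c0 := stdNormalCDF_nonneg z
  have c1 := stdNormalCDF_le_one z
  rcases le_total |z| 1 with hz | hz
  · have h1 : |P.real {ω | W ω ≤ z} - stdNormalCDF z| ≤ 1 := by
      rw [abs_le]; constructor <;> linarith
    have h2 : (1 + |z|) ^ 3 ≤ 2 ^ 3 := by
      gcongr; linarith
    calc _ ≤ (2 : ℝ) ^ 3 * 1 := mul_le_mul h2 h1 (abs_nonneg _) (by positivity)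
      _ ≤ _ := by linarith
  have hmarkov : |z| ^ 3 * P.real {ω | |z| ^ 3 ≤ |W ω| ^ 3} ≤ ∫ ω, |W ω| ^ 3 ∂P :=
    mul_meas_ge_le_integral_of_nonneg (ae_of_all _ fun ω => by positivity)
      ((hW.abs.pow 3).integrable P) _
  have hset : {ω | |z| ^ 3 ≤ |W ω| ^ 3} = {ω | |z| ≤ |W ω|} := by
    ext ω
    exact pow_le_pow_iff_left₀ (abs_nonneg z) (abs_nonneg (W ω)) three_ne_zero
  rw [hset] at hmarkov
  set p := P.real {ω | |z| ≤ |W ω|}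
  have hp : (1 + |z|) ^ 3 * p ≤ 8 * ∫ ω, |W ω| ^ 3 ∂P := by
    have : (1 + |z|) ^ 3 ≤ (2 * |z|) ^ 3 := by gcongr; linarith
    have h := mul_le_mul_of_nonneg_right this (measureReal_nonneg : 0 ≤ p)
    rw [mul_pow] at h
    linarith
  have hΦ := one_sub_stdNormalCDF_le hz
  have key : |P.real {ω | W ω ≤ z} - stdNormalCDF z| ≤ (1 - stdNormalCDF |z|) + p := by
    have q0 : 0 ≤ p := measureReal_nonneg
    rcases le_total 0 z with h0 | h0
    · have hc : 1 - P.real {ω | W ω ≤ z} ≤ p := by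
        rw [← probReal_compl_eq_one_sub (measurableSet_le hW.measurable measurable_const)]
        refine measureReal_mono fun ω hω => ?_
        have hω' : z < W ω := not_le.1 hω
        change |z| ≤ |W ω|
        rw [abs_of_nonneg h0]
        exact hω'.le.trans (le_abs_self _)
      rw [abs_of_nonneg h0, abs_le]
      constructor <;> linarith
    · have hc : P.real {ω | W ω ≤ z} ≤ p := by
        refine measureReal_mono fun ω hω => ?_
        have hω' : W ω ≤ z := hω
        change |z| ≤ |W ω|
        rw [abs_of_nonpos h0]
        exact (neg_le_neg hω').trans (neg_le_abs _)
      rw [abs_of_nonpos h0, stdNormalCDF_neg, abs_le]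
      constructor <;> linarith
  have := mul_le_mul_of_nonneg_left key (by positivity : 0 ≤ (1 + |z|) ^ 3)
  linarith

lemma integral_abs_pow_three_le {Ω : Type*} [MeasurableSpace Ω] (P : Measure Ω)
    [IsProbabilityMeasure P] {W : Ω → ℝ} (hW : BddMeas W) {ρ : ℝ} (hρ : 0 < ρ) :
    ∫ ω, |W ω| ^ 3 ∂P ≤ (ρ * ∫ ω, W ω ^ 2 ∂P + (∫ ω, W ω ^ 4 ∂P) / ρ) / 2 := by
  have b2 := (hW.pow 2).const_mul ρ
  have b4 := (hW.pow 4).div_const ρ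
  rw [← integral_const_mul, ← integral_div, ← integral_add (b2.integrable P) (b4.integrable P),
    ← integral_div]
  refine integral_mono ((hW.abs.pow 3).integrable P) (((b2.add b4).div_const 2).integrable P)
    fun ω => ?_
  simp only
  have e2 : W ω ^ 2 = |W ω| ^ 2 := (sq_abs _).symm
  have e4 : W ω ^ 4 = |W ω| ^ 4 := (Even.pow_abs (by decide) _).symm
  rw [e2, e4]
  set v := |W ω|
  have : ρ * v ^ 2 + v ^ 4 / ρ - 2 * v ^ 3 = (ρ * v - v ^ 2) ^ 2 / ρ := by
    field_simp; ring
  have h0 : 0 ≤ (ρ * v - v ^ 2) ^ 2 / ρ := by positivity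
  linarith

section Final

variable {V : Type*} [Fintype V] (μ : Measure ℝ) [IsProbabilityMeasure μ] {G : SimpleGraph V}
  [DecidableRel G.Adj] {d : ℕ}

/-- The nonuniform Berry-Esseen bound for the normalized number of local maxima. -/
lemma normCount_nonuniform_bound (hd : G.IsRegularOfDegree d) (hd1 : 1 ≤ d) [Nonempty V]
    {m σ : ℝ} (hσ : 0 < σ)
    (hm : m = ∫ x, locMaxCount G x ∂(Measure.pi fun _ : V => μ))
    (hv : variance (locMaxCount G) (Measure.pi fun _ : V => μ) = σ ^ 2) (z : ℝ) :
    (1 + |z|) ^ 3 * |(Measure.pi fun _ : V => μ.prod μ).real {y | normCount G m σ y ≤ z} -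
      stdNormalCDF z| ≤ 10 ^ 80 * ((d : ℝ) ^ 2 * Fintype.card V / σ ^ 3) := by
  have hc := swapCoupling_locMax μ G (σ := σ) hm
  have hd1' : (1 : ℝ) ≤ d := by exact_mod_cast hd1
  have hvar := sq_le_card μ hd hσ hm hv
  have hL := integral_normCount_pow_four_le μ hd hd1 hσ hm hv
  have hn : (0 : ℝ) < Fintype.card V := by exact_mod_cast Fintype.card_pos
  have hsteps := hc.nonuniform_bound (s := 10 ^ 7 * d ^ 2 * √(Fintype.card V : ℝ) / σ ^ 2)
    (by positivity) (integral_one_sub_gain_pow_four_le μ hd hd1 hσ hm hv)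
    (integral_absGain_pow_four_le μ hd hd1 hσ hm) z
  have htail := one_add_pow_three_mul_le (Measure.pi fun _ : V => μ.prod μ) hc.bddW z
  set L := ∫ y, normCount G m σ y ^ 4 ∂(Measure.pi fun _ : V => μ.prod μ)
  set n : ℝ := (Fintype.card V : ℝ)
  set s : ℝ := 10 ^ 7 * d ^ 2 * √n / σ ^ 2
  set ε : ℝ := (d : ℝ) ^ 2 * n / σ ^ 3 with hε
  have hε0 : 0 < ε := by positivity
  have hd2 : (1 : ℝ) ≤ (d : ℝ) ^ 2 := one_le_pow₀ hd1'
  -- The linear variance bound makes `√n / σ` bounded below, which trades `√n / σ²` for `n / σ³`.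
  have hs : s ≤ 10 ^ 19 * ε := by
    have h1 : σ ≤ 10 ^ 12 * √n := by
      apply le_of_sq_le_sq _ (by positivity)
      rw [mul_pow, Real.sq_sqrt hn.le]
      calc _ ≤ _ := hvar
        _ = _ := by ring
    have h2 : 10 ^ 19 * ε = 10 ^ 7 * d ^ 2 * √n / σ ^ 2 * (10 ^ 12 * √n / σ) := by
      rw [hε]
      nth_rewrite 1 [← Real.mul_self_sqrt hn.le]
      field_simp
    rw [h2]
    exact le_mul_of_one_le_right (by positivity) ((one_le_div hσ).2 h1)
  have hn3 : n * σ⁻¹ ^ 3 ≤ ε := by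
    have : ε = (d : ℝ) ^ 2 * (n * σ⁻¹ ^ 3) := by rw [hε]; field_simp
    rw [this]
    exact le_mul_of_one_le_left (by positivity) hd2
  have hn4 : n * σ⁻¹ ^ 4 ≤ 10 ^ 24 * ε ^ 2 := by
    have h1 : 10 ^ 24 * ε ^ 2 = (n * σ⁻¹ ^ 4) * ((d : ℝ) ^ 2 * d ^ 2 * (10 ^ 24 * n / σ ^ 2)) := by
      rw [hε]; field_simp
    rw [h1]
    refine le_mul_of_one_le_right (by positivity) (one_le_mul_of_one_le_of_one_le
      (one_le_mul_of_one_le_of_one_le hd2 hd2) ((one_le_div (by positivity)).2 hvar))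
  have hs0 : 0 < s := by positivity
  have hs2 : s ^ 2 ≤ 10 ^ 38 * ε ^ 2 := by
    calc s ^ 2 ≤ (10 ^ 19 * ε) ^ 2 := by gcongr
      _ = _ := by ring
  have hL' : L ≤ 10 ^ 50 * (1 + ε ^ 2) := by
    have : 2 * ε ≤ 1 + ε ^ 2 := by nlinarith [sq_nonneg (ε - 1)]
    nlinarith
  have hL0 : 0 ≤ L := integral_nonneg fun ω => by positivity
  -- For `ε ≤ 1` the fourth moment of `W` is bounded and Stein's bound applies. For `ε ≥ 1` it is
  -- `O(ε²)`; interpolating with `E W² = 1` gives `E |W|³ = O(ε)`, and the tail bound suffices.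
  rcases le_total ε 1 with h1 | h1
  · refine hsteps.trans ?_
    have h2 : L ≤ 10 ^ 50 * 2 := by nlinarith
    calc 600 * s * (2 + L) ≤ 600 * (10 ^ 19 * ε) * (2 + 10 ^ 50 * 2) := by gcongr
      _ ≤ 10 ^ 80 * ε := by nlinarith
  · have h3 := integral_abs_pow_three_le (Measure.pi fun _ : V => μ.prod μ) hc.bddW hε0
    rw [integral_normCount_sq μ G hσ hm hv] at h3
    have h4 : L / ε ≤ 10 ^ 50 * 2 * ε := by
      rw [div_le_iff₀ hε0]
      nlinarith
    linarith

lemma numLocalMax_eq_card {Ω : Type*} {Y : V → Ω → ℝ} (h : ∀ i j, ¬G.Adj i j) :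
    numLocalMax G Y = fun _ => (Fintype.card V : ℝ) := by
  funext ω
  simp [numLocalMax, localMaxIndicator, h]

end Final

/-! ### Transfer to the given random variables -/

theorem theorem2p8 :
    ∃ C : ℝ, 0 < C ∧
      ∀ {V Ω : Type*} [Fintype V] (G : SimpleGraph V) [DecidableRel G.Adj] (d : ℕ)
        (_ : G.IsRegularOfDegree d)
        [MeasurableSpace Ω] (P : Measure Ω) [IsProbabilityMeasure P]
        (Y : V → Ω → ℝ)
        (_ : ∀ i, Measurable (Y i))
        (_ : iIndepFun Y P)
        (_ : ∀ i j, IdentDistrib (Y i) (Y j) P P)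
        (_ : ∀ i (y : ℝ), P {ω | Y i ω = y} = 0)
        (W : Ω → ℝ) (_ : W = numLocalMax G Y)
        (m σ : ℝ) (_ : m = ∫ ω, W ω ∂P) (_ : σ = √(variance W P))
        (_ : 0 < σ),
        (∀ z : ℝ, |P.real {ω | W ω ≤ z} - stdNormalCDF ((z - m) / σ)|
            ≤ C * (d : ℝ) ^ 2 * (Fintype.card V : ℝ) / σ ^ 3) ∧
        (∀ z : ℝ, |P.real {ω | W ω ≤ z} - stdNormalCDF ((z - m) / σ)|
            ≤ C * ((1 + |(z - m) / σ|) ^ 3)⁻¹ * (d : ℝ) ^ 5 * (Fintype.card V : ℝ) / σ ^ 3) := by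
  refine ⟨10 ^ 80, by positivity, ?_⟩
  intro V Ω _ G _ d hd _ P _ Y hY hind hid _ W hW m σ hm hσv hσ
  -- Without edges every vertex is vacuously a local maximum and the variance is zero. So `σ > 0`
  -- forces `d ≥ 1`.
  have hedge : ∃ i j, G.Adj i j := by
    by_contra hno
    push Not at hno
    rw [hW, numLocalMax_eq_card hno] at hσv
    have : variance (fun _ : Ω => (Fintype.card V : ℝ)) P = 0 := by
      rw [variance_eq_integral measurable_const.aemeasurable]; simp
    rw [this, Real.sqrt_zero] at hσv
    exact hσ.ne' hσv
  obtain ⟨v₀, v₁, hadj⟩ := hedge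
  have : Nonempty V := ⟨v₀⟩
  have hd1 : 1 ≤ d := by
    rw [← hd v₀]
    exact (G.degree_pos_iff_exists_adj v₀).2 ⟨v₁, hadj⟩
  set μ := P.map (Y v₀) with hμ
  have : IsProbabilityMeasure μ := Measure.isProbabilityMeasure_map (hY v₀).aemeasurable
  have hYm : Measurable fun ω v => Y v ω := measurable_pi_iff.2 hY
  have hlaw : MeasurePreserving (fun ω v => Y v ω) P (Measure.pi fun _ : V => μ) := by
    refine ⟨hYm, ?_⟩
    rw [(iIndepFun_iff_map_fun_eq_pi_map fun i => (hY i).aemeasurable).1 hind]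
    congr 1
    funext v
    exact (hid v v₀).map_eq
  have hWf : ∀ ω, W ω = locMaxCount G fun v => Y v ω := by
    intro ω
    rw [hW]
    rfl
  have bf := bddMeas_locMaxCount G
  have hW' : W = locMaxCount G ∘ fun ω v => Y v ω := funext hWf
  have hm' : m = ∫ x, locMaxCount G x ∂(Measure.pi fun _ : V => μ) := by
    rw [hm, ← hlaw.map_eq, integral_map hYm.aemeasurable bf.measurable.aestronglyMeasurable]
    simp only [hWf]
  have hv' : variance (locMaxCount G) (Measure.pi fun _ : V => μ) = σ ^ 2 := by
    rw [hσv, Real.sq_sqrt (variance_nonneg _ _), hW', ← hlaw.map_eq,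
      variance_map bf.measurable.aemeasurable hYm.aemeasurable]
  -- The first copy in the doubled space has the law of `Y`, so the standardized counts agree in
  -- law.
  have hcdf : ∀ z, P.real {ω | W ω ≤ z} = (Measure.pi fun _ : V => μ.prod μ).real
      {y | normCount G m σ y ≤ (z - m) / σ} := by
    intro z
    have hms : MeasurableSet {x : V → ℝ | locMaxCount G x ≤ z} :=
      measurableSet_le bf.measurable measurable_const
    have h1 := hlaw.measureReal_preimage hms.nullMeasurableSet
    have h2 := (measurePreserving_mix μ (∅ : Set V)).measureReal_preimage hms.nullMeasurableSet
    have e1 : {ω | W ω ≤ z} = (fun ω v => Y v ω) ⁻¹' {x : V → ℝ | locMaxCount G x ≤ z} := by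
      ext ω; simp [hWf]
    have e2 : {y | normCount G m σ y ≤ (z - m) / σ} =
        mix (∅ : Set V) ⁻¹' {x : V → ℝ | locMaxCount G x ≤ z} := by
      ext y
      simp [normCount, div_le_div_iff_of_pos_right hσ]
    rw [e1, e2, h1, h2]
  have main : ∀ z, (1 + |(z - m) / σ|) ^ 3 *
      |P.real {ω | W ω ≤ z} - stdNormalCDF ((z - m) / σ)| ≤
      10 ^ 80 * ((d : ℝ) ^ 2 * Fintype.card V / σ ^ 3) := fun z => by
    rw [hcdf]
    exact normCount_nonuniform_bound μ hd hd1 hσ hm' hv' _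
  have hd1' : (1 : ℝ) ≤ d := by exact_mod_cast hd1
  -- The uniform bound drops a weight that is at least one; the nonuniform one weakens `d²` to `d⁵`.
  refine ⟨fun z => ?_, fun z => ?_⟩
  · have h1 : (1 : ℝ) ≤ (1 + |(z - m) / σ|) ^ 3 :=
      one_le_pow₀ (by linarith [abs_nonneg ((z - m) / σ)])
    calc _ ≤ _ := le_mul_of_one_le_left (abs_nonneg _) h1
      _ ≤ _ := main z
      _ = _ := by ring
  · have hp : 0 < (1 + |(z - m) / σ|) ^ 3 := by positivity
    have h25 : (d : ℝ) ^ 2 ≤ (d : ℝ) ^ 5 := pow_le_pow_right₀ hd1' (by norm_num)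
    calc _ ≤ ((1 + |(z - m) / σ|) ^ 3)⁻¹ * (10 ^ 80 * ((d : ℝ) ^ 2 * Fintype.card V / σ ^ 3)) := by
          rw [inv_mul_eq_div, le_div_iff₀ hp, mul_comm]
          exact main z
      _ ≤ ((1 + |(z - m) / σ|) ^ 3)⁻¹ * (10 ^ 80 * ((d : ℝ) ^ 5 * Fintype.card V / σ ^ 3)) := by
          gcongr
      _ = _ := by ring
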